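/- A parameterised function is a function $F\colon\{0,1\}^*\times\mathbb N\to\mathbb N$. A machine is a deterministic multitape Turing machine whose read-only input, a binary encoding of $(x,k)$, is accessed through a random access tape: the machine sees the input bit at the position written there in binary. A nondeterministic machine has in addition a read-only choice tape with bits $y_0,y_1,\dots$; its accepting paths on an input are the finite sequences $y$ such that, with the choice tape starting with $y$, the machine accepts and visits exactly the cells that hold $y$. The machine is a para-L-machine if for some computable $f\colon\mathbb N\to\mathbb N$ it works, on all inputs $(x,k)$ (and all contents of the choice tape), in space $O(\log(|x|+f(k)))$ and in time $(|x|+f(k))^{O(1)}$. It is $k$-bounded if for some computable $f$ it visits, on all inputs $(x,k)$, at most $f(k)\cdot\lfloor\log_2(|x|+2)\rfloor$ cells of the choice tape. The class $\#\mathrm{para}_{\mathrm W}\text{-}\mathrm L$ consists of the parameterised functions $F$ for which there is a $k$-bounded nondeterministic para-L-machine having, on every input $(x,k)$, exactly $F(x,k)$ accepting paths. The class $\#\mathrm{para}_{\beta}\text{-}\mathrm L$ is defined in the same way by machines whose head on the choice tape never moves left (read-once access). A function $F$ is para-logspace parsimoniously reducible to $F'$ if there are a deterministic para-L oracle machine $M$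 (whose write-only oracle tape is exempt from the space bound) and a computable $g$ such that on every input $(x,k)$ the machine $M$ asks an oracle query $(x',k')$ with $k'\le g(k)$ and immediately returns its answer $F'(x',k')$, and $F(x,k)=F'(x',k')$. **Lemma.** The classes $\#\mathrm{para}_{\mathrm W}\text{-}\mathrm L$ and $\#\mathrm{para}_{\beta}\text{-}\mathrm L$ are closed under para-logspace parsimonious reductions: if $F$ is para-logspace parsimoniously reducible to $F'$ and $F'$ belongs to one of the two classes, then $F$ belongs to the same class. -/

import Mathlib

namespace ParaLog

/-! ## Turing machines with random access to the input -/

/-- Head moves. Work tapes are infinite to the right only; moving left from cell `0` has no effect. -/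
inductive Move where
  | left
  | stay
  | right

def Move.apply : Move → ℕ → ℕ
  | .left, p => p - 1
  | .stay, p => p
  | .right, p => p + 1

/-- A work tape over the alphabet `{0, 1, blank}`, with `none` as the blank symbol. -/
structure WorkTape where
  cells : ℕ → Option Bool
  pos : ℕ

namespace WorkTape

def blank : WorkTape := ⟨fun _ => none, 0⟩

def read (τ : WorkTape) : Option Bool := τ.cells τ.pos

/-- Write a symbol into the scanned cell, then move the head. -/
def act (τ : WorkTape) (s : Option Bool) (m : Move) : WorkTape :=
  ⟨Function.update τ.cells τ.pos s, m.apply τ.pos⟩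

/-- The number written on the tape in binary, with the digit of weight `2 ^ i` in cell `i`
(blank cells count as `0`; on all tapes that occur in a run only finitely many cells are
not blank). -/
noncomputable def value (τ : WorkTape) : ℕ :=
  ∑ᶠ i : ℕ, if τ.cells i = some true then 2 ^ i else 0

end WorkTape

/-- A deterministic multitape Turing machine with random access to a read-only input word.
`ra` is the random access tape: in every step the machine sees the input bit at the position
written there (`none` if the input is too short). Besides, in every step it reads a symbol
from `I` and performs an action from `A` on an additional tape (the choice tape or the
oracle tape below). A step depends on the state, the scanned symbols of all work tapes,
the input bit and the symbol from `I`, and consists of a new state, a symbol to write and a head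
move for every work tape, and an action. -/
structure Machine (I A : Type) where
  State : Type
  Tape : Type
  finite_state : Finite State
  finite_tape : Finite Tape
  ra : Tape
  start : State
  /-- the states in which the computation ends -/
  final : State → Bool
  δ : State → (Tape → Option Bool) → Option Bool → I →
    State × (Tape → Option Bool × Move) × A

namespace Machine

variable {I A : Type}

structure Config (M : Machine I A) where
  state : M.State
  tapes : M.Tape → WorkTape

def init (M : Machine I A) : M.Config := ⟨M.start, fun _ => WorkTape.blank⟩

/-- The output of the transition function in configuration `c`, on input word `w`,
with symbol `i` on the additional tape. -/
noncomputable def trans (M : Machine I A) (w : List Bool) (c : M.Config) (i : I) :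
    M.State × (M.Tape → Option Bool × Move) × A :=
  M.δ c.state (fun j => (c.tapes j).read) (w[(c.tapes M.ra).value]?) i

/-- The next configuration of finite control and work tapes. -/
noncomputable def next (M : Machine I A) (w : List Bool) (c : M.Config) (i : I) : M.Config where
  state := (M.trans w c i).1
  tapes j := (c.tapes j).act ((M.trans w c i).2.1 j).1 ((M.trans w c i).2.1 j).2

end Machine

/-! ## Nondeterministic machines: machines with a choice tape -/

/-- A machine with a read-only choice tape. Cell `0` of the choice tape is a left end marker,
read as `none`, on which the head starts; cells `1, 2, …` hold the choice bits.
The machine accepts if it ends in a final state that is `accepting`. -/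
structure ChoiceMachine extends Machine (Option Bool) Move where
  accepting : State → Bool

namespace ChoiceMachine

structure Config (M : ChoiceMachine) where
  core : M.toMachine.Config
  choicePos : ℕ

/-- The symbol in cell `p` of the choice tape holding the bits `y 0, y 1, …`. -/
def choiceSymbol (y : ℕ → Bool) : ℕ → Option Bool
  | 0 => none
  | p + 1 => some (y p)

/-- One step; configurations with a final state do not change any more. -/
noncomputable def step (M : ChoiceMachine) (w : List Bool) (y : ℕ → Bool) (c : M.Config) :
    M.Config :=
  if M.final c.core.state then c
  else
    { core := M.next w c.core (choiceSymbol y c.choicePos)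
      choicePos :=
        (M.trans w c.core (choiceSymbol y c.choicePos)).2.2.apply c.choicePos }

/-- The configuration after `t` steps on input `w` with choice bits `y`. -/
noncomputable def run (M : ChoiceMachine) (w : List Bool) (y : ℕ → Bool) (t : ℕ) : M.Config :=
  (M.step w y)^[t] ⟨M.init, 0⟩

/-- One-way (read-once) access to the choice tape: its head never moves left. -/
def ReadOnce (M : ChoiceMachine) : Prop :=
  ∀ q s b i, (M.δ q s b i).2.2 ≠ Move.left

/-- The accepting paths on input `w`. A path is identified with the finite sequence of
choice bits in the cells visited along it: if the choice tape starts with `y`, then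
the machine accepts and visits exactly the first `y.length` choice bits (the padding of `y`
by `false` is never seen). -/
def acceptingPaths (M : ChoiceMachine) (w : List Bool) : Set (List Bool) :=
  {y | (∃ t, M.final (M.run w (fun i => y.getD i false) t).core.state = true ∧
          M.accepting (M.run w (fun i => y.getD i false) t).core.state = true) ∧
        IsGreatest (Set.range fun t => (M.run w (fun i => y.getD i false) t).choicePos) y.length}

end ChoiceMachine

/-! ## Oracle machines that return the answer of their first oracle query -/

/-- A deterministic machine with a write-only oracle tape, to which it can append a bit in each
step. On entering a final state it asks the word on the oracle tape as its only query,
and the answer of the oracle is immediately returned as the result. -/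
abbrev OracleMachine : Type 1 := Machine Unit (Option Bool)

namespace OracleMachine

structure Config (M : OracleMachine) where
  core : Machine.Config M
  oracleTape : List Bool

noncomputable def step (M : OracleMachine) (w : List Bool) (c : Config M) : Config M :=
  if M.final c.core.state then c
  else
    { core := Machine.next M w c.core ()
      oracleTape := c.oracleTape ++ (Machine.trans M w c.core ()).2.2.toList }

noncomputable def run (M : OracleMachine) (w : List Bool) (t : ℕ) : Config M :=
  (step M w)^[t] ⟨Machine.init M, []⟩

/-- On input `w`, the oracle query of `M` is the word `v`. -/
def Queries (M : OracleMachine) (w v : List Bool) : Prop :=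
  ∃ t, M.final (run M w t).core.state = true ∧ (run M w t).oracleTape = v

end OracleMachine

/-! ## Parameterised functions, resource bounds and counting classes -/

/-- Functions `{0,1}* × ℕ → ℕ`; the second argument is the parameter. -/
abbrev ParamFun : Type := List Bool → ℕ → ℕ

/-- The encoding `1 ^ k 0 x` of a parameterised input `(x, k)` as a word. -/
def encodeInput (x : List Bool) (k : ℕ) : List Bool :=
  List.replicate k true ++ false :: x

/-- `M` is a para-L-machine: for some computable `f`, on all inputs `(x, k)` and for all
contents of the choice tape it is `O(log (|x| + f k))` space-bounded (on each of the finitely many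
work tapes, including the random access tape) and halts in time polynomial in `|x| + f k`. -/
def ChoiceMachine.IsParaL (M : ChoiceMachine) : Prop :=
  ∃ (f : ℕ → ℕ) (c : ℕ), Computable f ∧ ∀ (x : List Bool) (k : ℕ) (y : ℕ → Bool),
    (∀ t j, ((M.run (encodeInput x k) y t).core.tapes j).pos < c * Nat.log 2 (x.length + f k)) ∧
    ∃ t ≤ (x.length + f k) ^ c, M.final (M.run (encodeInput x k) y t).core.state = true

/-- The same bounds for oracle machines; the oracle tape is exempt from the space bound. -/
def OracleMachine.IsParaL (M : OracleMachine) : Prop :=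
  ∃ (f : ℕ → ℕ) (c : ℕ), Computable f ∧ ∀ (x : List Bool) (k : ℕ),
    (∀ t j, ((OracleMachine.run M (encodeInput x k) t).core.tapes j).pos <
      c * Nat.log 2 (x.length + f k)) ∧
    ∃ t ≤ (x.length + f k) ^ c,
      M.final (OracleMachine.run M (encodeInput x k) t).core.state = true

/-- `M` is `k`-bounded: on input `(x, k)` it visits at most `f k * log |x|` cells of the choice tape,
for a computable `f`. Here `log |x|` is read as `⌊log₂ (|x| + 2)⌋`, so that it is positive
for words of length `0` and `1` as well. -/
def ChoiceMachine.IsKBounded (M : ChoiceMachine) : Prop :=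
  ∃ f : ℕ → ℕ, Computable f ∧ ∀ (x : List Bool) (k : ℕ) (y : ℕ → Bool) (t : ℕ),
    (M.run (encodeInput x k) y t).choicePos ≤ f k * Nat.log 2 (x.length + 2)

/-- `F (x, k)` is the number of accepting paths of `M` on input `(x, k)`. -/
def ChoiceMachine.Counts (M : ChoiceMachine) (F : ParamFun) : Prop :=
  ∀ (x : List Bool) (k : ℕ), (M.acceptingPaths (encodeInput x k)).encard = (F x k : ℕ∞)

/-- The class `#para_W-L`. -/
def SharpParaWL : Set ParamFun :=
  {F | ∃ M : ChoiceMachine, M.IsParaL ∧ M.IsKBounded ∧ M.Counts F}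

/-- The class `#para_β-L`. -/
def SharpParaBetaL : Set ParamFun :=
  {F | ∃ M : ChoiceMachine, M.IsParaL ∧ M.IsKBounded ∧ M.ReadOnce ∧ M.Counts F}

/-- `F` is para-logspace parsimoniously reducible to `F'`: a para-L oracle machine computes `F`
with oracle `F'` by returning the answer of its first query `(x', k')`,
whose parameter is bounded by a computable function of the parameter. -/
def ParsReducible (F F' : ParamFun) : Prop :=
  ∃ M : OracleMachine, OracleMachine.IsParaL M ∧
    ∃ g : ℕ → ℕ, Computable g ∧ ∀ (x : List Bool) (k : ℕ), ∃ (x' : List Bool) (k' : ℕ),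
      OracleMachine.Queries M (encodeInput x k) (encodeInput x' k') ∧
      k' ≤ g k ∧ F x k = F' x' k'

end ParaLog

/-!
Let `R` be the oracle machine of the reduction and `N` a counting machine for `F'`. The query of `R`
is too long to be stored, so `N` is simulated on it as on a virtual input: whenever `N` makes
a step, its input bit, at the position `p` written on its random access tape, is recomputed by running
`R` from the start and skipping the first `p` bits that `R` writes on its oracle tape. All this
is deterministic and leaves the choice tape alone; its head moves exactly when the simulated
head of `N` does. So, for every content `y` of the choice tape, the composition visits the same
choice cells as `N` on the query and ends in the same verdict. Hence both have literally the same
accepting paths (`compose.acceptingPaths_eq`), and read-once access is inherited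
(`compose.readOnce`).

The composition is written as a `CellMachine`, whose tapes have four tracks; an ordinary choice
machine keeps the tracks on separate tapes with heads in lockstep. Besides the content of the
simulated tape there is a track that makes the left end and the visited part of the tape recognisable,
and on the random access tape of `N` a binary counter for the bits still to be skipped and a mark for
the position to which the head has to return. Loading and decrementing the counter, erasing the tapes
of `R`, and all moves of heads in between are sweeps, in which every head runs over its visited
cells until a local condition holds (`Sweeps`, `CellMachine.reach_sweep`).

If both machines keep their heads left of cell `S`, so does the composition up to one cell,
and one step of `N` costs at most `TR * (2 * S + 3) + 4 * S + 6` steps, where `TR` is the running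
time of `R` (`compose.reach_step`). The query has length at most `TR`, which is polynomial
in `|x| + f k`, and its parameter is at most `g k`; replacing the bounds of `N` by their sums over all
parameters up to `g k` keeps them computable and yields the bounds for the composition
(`compose_spec`).
-/

namespace ParaLog

/-! ### Machines with four-track tapes -/

/-- The four tracks of a tape of a `CellMachine`. -/
inductive Track where
  | data
  | edge
  | count
  | home

instance : Finite Track :=
  Finite.of_injective (β := Fin 4) (fun | .data => 0 | .edge => 1 | .count => 2 | .home => 3)
    (by rintro (_ | _ | _ | _) (_ | _ | _ | _) h <;> simp_all)

/-- A tape cell with four tracks: `data` is the content of a simulated tape, `edge` is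
`some true` in cell `0`, `some false` in the other visited cells and blank beyond, `count` holds
the digits of a binary counter, and `home` marks a head position. -/
structure Cell where
  data : Option Bool
  edge : Option Bool
  count : Option Bool
  home : Option Bool

namespace Cell

/-- The symbol on a given track. -/
def get (c : Cell) : Track → Option Bool
  | .data => c.data
  | .edge => c.edge
  | .count => c.count
  | .home => c.home

/-- The cell with given symbols on its tracks. -/
def ofTracks (s : Track → Option Bool) : Cell := ⟨s .data, s .edge, s .count, s .home⟩

end Cell

/-- A tape of four-track cells with a single head. -/
structure CellTape where
  cells : ℕ → Cell
  pos : ℕ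

namespace CellTape

def blank : CellTape := ⟨fun _ => ⟨none, none, none, none⟩, 0⟩

def read (τ : CellTape) : Cell := τ.cells τ.pos

def act (τ : CellTape) (s : Cell) (m : Move) : CellTape :=
  ⟨Function.update τ.cells τ.pos s, m.apply τ.pos⟩

/-- A single track of a tape, with the common head. -/
def track (τ : CellTape) (i : Track) : WorkTape := ⟨fun n => (τ.cells n).get i, τ.pos⟩

theorem track_act (τ : CellTape) (s : Cell) (m : Move) (i : Track) :
    (τ.act s m).track i = (τ.track i).act (s.get i) m := by
  simp only [track, act, WorkTape.act, WorkTape.mk.injEq, and_true]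
  funext n
  by_cases h : n = τ.pos <;> simp [h]

theorem track_blank (i : Track) : blank.track i = WorkTape.blank := by
  cases i <;> rfl

theorem act_read_stay (τ : CellTape) : τ.act τ.read .stay = τ := by
  simp [act, read, Move.apply]

end CellTape

/-- A machine with a choice tape whose work tapes consist of four-track cells.
Its random access tape is the data track of the tape `ra`. -/
structure CellMachine where
  State : Type
  Tape : Type
  finite_state : Finite State
  finite_tape : Finite Tape
  ra : Tape
  start : State
  final : State → Bool
  accepting : State → Bool
  δ : State → (Tape → Cell) → Option Bool → Option Bool →
    State × (Tape → Cell × Move) × Move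

namespace CellMachine

/-- The choice machine that keeps every track on a tape of its own, the heads of the four tracks
of a tape moving in lockstep. -/
def toChoiceMachine (M : CellMachine) : ChoiceMachine where
  State := M.State
  Tape := M.Tape × Track
  finite_state := M.finite_state
  finite_tape := by have := M.finite_tape; infer_instance
  ra := (M.ra, .data)
  start := M.start
  final := M.final
  δ q s b i :=
    ((M.δ q (fun j => Cell.ofTracks fun i => s (j, i)) b i).1,
      fun a => (((M.δ q (fun j => Cell.ofTracks fun i => s (j, i)) b i).2.1 a.1).1.get a.2,
        ((M.δ q (fun j => Cell.ofTracks fun i => s (j, i)) b i).2.1 a.1).2),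
      (M.δ q (fun j => Cell.ofTracks fun i => s (j, i)) b i).2.2)
  accepting := M.accepting

/-- A configuration: the state, the work tapes, and the head position on the choice tape. -/
structure Config (M : CellMachine) where
  state : M.State
  tapes : M.Tape → CellTape
  choicePos : ℕ

variable {M : CellMachine}

/-- The output of the transition function in configuration `c`. -/
noncomputable def out (w : List Bool) (y : ℕ → Bool) (c : M.Config) :
    M.State × (M.Tape → Cell × Move) × Move :=
  M.δ c.state (fun j => (c.tapes j).read) (w[((c.tapes M.ra).track .data).value]?)
    (ChoiceMachine.choiceSymbol y c.choicePos)

/-- The configuration after performing the output `o` of the transition function, with tapes `V`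
and the head on the choice tape in cell `p`. -/
def perform (V : M.Tape → CellTape) (p : ℕ) (o : M.State × (M.Tape → Cell × Move) × Move) :
    M.Config :=
  ⟨o.1, fun j => (V j).act (o.2.1 j).1 (o.2.1 j).2, o.2.2.apply p⟩

/-- One step; configurations with a final state do not change any more. -/
noncomputable def step (w : List Bool) (y : ℕ → Bool) (c : M.Config) : M.Config :=
  if M.final c.state then c else perform c.tapes c.choicePos (out w y c)

theorem step_of_final {w : List Bool} {y : ℕ → Bool} (c : M.Config)
    (h : M.final c.state = true) : step w y c = c :=
  if_pos h

/-- The configuration after `t` steps on input `w` with choice bits `y`. -/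
noncomputable def run (M : CellMachine) (w : List Bool) (y : ℕ → Bool) (t : ℕ) : M.Config :=
  (step w y)^[t] ⟨M.start, fun _ => CellTape.blank, 0⟩

/-- The configuration of `M.toChoiceMachine` with every track on its own tape. -/
def Config.toChoice (c : M.Config) : M.toChoiceMachine.Config :=
  ⟨⟨c.state, fun a => (c.tapes a.1).track a.2⟩, c.choicePos⟩

theorem toChoice_step (w : List Bool) (y : ℕ → Bool) (c : M.Config) :
    M.toChoiceMachine.step w y c.toChoice = (step w y c).toChoice := by
  unfold step ChoiceMachine.step
  by_cases h : M.final c.state = true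
  · have h' : M.toChoiceMachine.final c.toChoice.core.state = true := h
    rw [if_pos h, if_pos h']
  · have h' : ¬ M.toChoiceMachine.final c.toChoice.core.state = true := h
    rw [if_neg h, if_neg h']
    simp only [perform, Config.toChoice, CellTape.track_act]
    rfl

theorem toChoice_run (w : List Bool) (y : ℕ → Bool) (t : ℕ) :
    M.toChoiceMachine.run w y t = (M.run w y t).toChoice := by
  induction t with
  | zero =>
    simp only [ChoiceMachine.run, run, Function.iterate_zero, id, Config.toChoice,
      CellTape.track_blank]
    rfl
  | succ t ih =>
    simp only [ChoiceMachine.run, run, Function.iterate_succ_apply'] at ih ⊢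
    rw [ih, toChoice_step]

/-! ### Bounded reachability -/

/-- `c'` is reached from `c` in at most `B` steps, all configurations before `c'` satisfying `P`. -/
def Reach (w : List Bool) (y : ℕ → Bool) (P : M.Config → Prop) (B : ℕ) (c c' : M.Config) :
    Prop :=
  ∃ t ≤ B, (step w y)^[t] c = c' ∧ ∀ s < t, P ((step w y)^[s] c)

section Reach

variable {w : List Bool} {y : ℕ → Bool} {P : M.Config → Prop} {B B' : ℕ} {c c' c'' : M.Config}

theorem Reach.refl (c : M.Config) : Reach w y P B c c :=
  ⟨0, Nat.zero_le _, rfl, by simp⟩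

theorem Reach.single (hP : P c) (h : step w y c = c') : Reach w y P 1 c c' :=
  ⟨1, le_rfl, h, fun s hs => by obtain rfl : s = 0 := by omega
                                exact hP⟩

theorem Reach.trans (h : Reach w y P B c c') (h' : Reach w y P B' c' c'') :
    Reach w y P (B + B') c c'' := by
  obtain ⟨t, ht, rfl, hP⟩ := h
  obtain ⟨t', ht', rfl, hP'⟩ := h'
  refine ⟨t + t', by omega, by rw [add_comm, Function.iterate_add_apply], fun s hs => ?_⟩
  rcases lt_or_ge s t with h | h
  · exact hP s h
  · have := hP' (s - t) (by omega)
    rwa [← Function.iterate_add_apply, Nat.sub_add_cancel h] at this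

theorem Reach.mono (h : Reach w y P B c c') (hB : B ≤ B') : Reach w y P B' c c' := by
  obtain ⟨t, ht, h⟩ := h
  exact ⟨t, ht.trans hB, h⟩

end Reach

end CellMachine

/-! ### Parallel sweeps -/

/-- A program for a single head: act on the scanned cell, or stop (`none`). -/
abbrev HeadOp : Type := Cell → Option (Cell × Move)

/-- Running the program `op` on a tape `τ` yields `τ'` in at most `B` actions, the head staying
within the cells `0, …, S`. -/
inductive Sweeps (op : HeadOp) (S : ℕ) : ℕ → CellTape → CellTape → Prop
  | done {B : ℕ} {τ : CellTape} : op τ.read = none → τ.pos ≤ S → Sweeps op S B τ τ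
  | step {B : ℕ} {τ τ' : CellTape} {a : Cell × Move} : op τ.read = some a → τ.pos ≤ S →
      Sweeps op S B (τ.act a.1 a.2) τ' → Sweeps op S (B + 1) τ τ'

namespace Sweeps

theorem pos_le {op : HeadOp} {S B : ℕ} {τ τ' : CellTape} (h : Sweeps op S B τ τ') :
    τ.pos ≤ S := by
  cases h <;> assumption

theorem mono {op : HeadOp} {S B B' : ℕ} {τ τ' : CellTape} (h : Sweeps op S B τ τ')
    (hB : B ≤ B') : Sweeps op S B' τ τ' := by
  induction h generalizing B' with
  | done h hp => exact .done h hp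
  | step h hp _ ih =>
    obtain ⟨B', rfl⟩ : ∃ b, B' = b + 1 := ⟨B' - 1, by omega⟩
    exact .step h hp (ih (by omega))

theorem eq_of_none {op : HeadOp} {S B : ℕ} {τ τ' : CellTape} (h : Sweeps op S B τ τ')
    (h' : op τ.read = none) : τ = τ' := by
  cases h with
  | done _ _ => rfl
  | step h _ _ => rw [h'] at h; cases h

theorem read_eq_none {op : HeadOp} {S : ℕ} {τ τ' : CellTape} (h : Sweeps op S 0 τ τ') :
    op τ.read = none := by
  cases h; assumption

end Sweeps

open Classical in
/-- Move left up to the first cell satisfying `target`. -/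
noncomputable def goLeft (target : Cell → Prop) : HeadOp := fun c =>
  if target c then none else some (c, .left)

open Classical in
/-- Move right up to the first cell satisfying `target`, applying `f` to the cells passed. -/
noncomputable def goRight (target : Cell → Prop) (f : Cell → Cell) : HeadOp := fun c =>
  if target c then none else some (f c, .right)

theorem sweeps_goLeft {target : Cell → Prop} {C : ℕ → Cell} {S p : ℕ} (hp : target (C p)) (d : ℕ)
    (hd : ∀ k, p < k → k ≤ p + d → ¬ target (C k)) (hS : p + d ≤ S) :
    Sweeps (goLeft target) S d ⟨C, p + d⟩ ⟨C, p⟩ := by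
  induction d with
  | zero => exact .done (by simp [goLeft, CellTape.read, hp]) hS
  | succ d ih =>
    have h : ¬ target (C (p + (d + 1))) := hd _ (by omega) le_rfl
    refine .step (a := (C (p + (d + 1)), .left)) (by simp [goLeft, CellTape.read, h]) hS ?_
    have := ih (fun k h1 h2 => hd k h1 (by omega)) (by omega)
    convert this using 1
    simp [CellTape.act, Move.apply]

theorem sweeps_goRight {target : Cell → Prop} {f : Cell → Cell} {S : ℕ} (d : ℕ) {C : ℕ → Cell}
    {p : ℕ} (hp : target (C (p + d))) (hd : ∀ k, p ≤ k → k < p + d → ¬ target (C k))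
    (hS : p + d ≤ S) :
    Sweeps (goRight target f) S d ⟨C, p⟩
      ⟨fun k => if p ≤ k ∧ k < p + d then f (C k) else C k, p + d⟩ := by
  induction d generalizing C p with
  | zero =>
    have : (fun k => if p ≤ k ∧ k < p + 0 then f (C k) else C k) = C := by
      funext k
      rw [if_neg (by omega)]
    rw [this]
    exact .done (by simp only [add_zero] at hp; simp [goRight, CellTape.read, hp]) hS
  | succ d ih =>
    have h : ¬ target (C p) := hd _ le_rfl (by omega)
    refine .step (a := (f (C p), .right)) (by simp [goRight, CellTape.read, h])
      (show p ≤ S by omega) ?_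
    have := @ih (Function.update C p (f (C p))) (p + 1)
      (by rw [Function.update_of_ne (by omega)]; convert hp using 2; omega)
      (fun k h1 h2 => by
        rw [Function.update_of_ne (by omega)]; exact hd k (by omega) (by omega)) (by omega)
    have hC : (fun k => if p ≤ k ∧ k < p + (d + 1) then f (C k) else C k) =
        fun k => if p + 1 ≤ k ∧ k < p + 1 + d then f (Function.update C p (f (C p)) k)
          else Function.update C p (f (C p)) k := by
      funext k
      by_cases hk : k = p
      · subst hk
        simp
      · rw [Function.update_of_ne hk]
        exact if_congr (by omega) rfl rfl
    rw [hC, show p + (d + 1) = p + 1 + d by omega]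
    exact this

open Classical in
/-- The output of the transition function in a state `q` that runs the programs `op` on all tapes
in parallel and behaves like `exit` once all of them have stopped. -/
noncomputable def sweep {Q J : Type} (q : Q) (op : J → HeadOp) (s : J → Cell)
    (exit : Q × (J → Cell × Move) × Move) : Q × (J → Cell × Move) × Move :=
  if ∀ j, op j (s j) = none then exit
  else (q, fun j => (op j (s j)).getD (s j, .stay), .stay)

namespace CellMachine

variable {M : CellMachine}

/-- The heads of the work tapes are in the cells `0, …, S`, and the head on the choice tape
is in cell `p`. -/
def Within (S p : ℕ) (c : M.Config) : Prop :=
  c.choicePos = p ∧ ∀ j, (c.tapes j).pos ≤ S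

/-- A sweep state runs its programs on all tapes; `B` bounds the time because the tapes are
swept in parallel, the heads that are done waiting for the others. -/
theorem reach_swept {w : List Bool} {y : ℕ → Bool} {S p : ℕ} {q : M.State}
    {op : M.Tape → HeadOp}
    {ex : (M.Tape → Cell) → Option Bool → M.State × (M.Tape → Cell × Move) × Move}
    (hq : M.final q = false) (hδ : ∀ s b i, M.δ q s b i = sweep q op s (ex s i))
    (B : ℕ) {V V' : M.Tape → CellTape} (h : ∀ j, Sweeps (op j) S B (V j) (V' j)) :
    Reach w y (Within S p) B ⟨q, V, p⟩ ⟨q, V', p⟩ ∧ ∀ j, op j (V' j).read = none := by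
  induction B generalizing V with
  | zero =>
    have hn : ∀ j, op j (V j).read = none := fun j => (h j).read_eq_none
    obtain rfl : V = V' := funext fun j => (h j).eq_of_none (hn j)
    exact ⟨.refl _, hn⟩
  | succ B ih =>
    by_cases hn : ∀ j, op j (V j).read = none
    · obtain rfl : V = V' := funext fun j => (h j).eq_of_none (hn j)
      exact ⟨.refl _, hn⟩
    · obtain ⟨h1, h2⟩ := @ih
        (fun j => (V j).act ((op j (V j).read).getD ((V j).read, .stay)).1
          ((op j (V j).read).getD ((V j).read, .stay)).2) (fun j => by
        generalize hτ : V j = τ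
        have hj := h j
        rw [hτ] at hj
        cases hj with
        | done h hp =>
          rw [h, Option.getD_none, CellTape.act_read_stay]
          exact .done h hp
        | step h hp h' => rwa [h, Option.getD_some])
      refine ⟨?_, h2⟩
      rw [add_comm]
      refine Reach.trans (Reach.single ⟨rfl, fun j => (h j).pos_le⟩ ?_) h1
      simp [step, perform, hq, out, hδ, sweep, hn, Move.apply]

/-- A sweep state runs its programs on all tapes and then makes its exit step. -/
theorem reach_sweep {w : List Bool} {y : ℕ → Bool} {S p B : ℕ} {q : M.State}
    {op : M.Tape → HeadOp}
    {ex : (M.Tape → Cell) → Option Bool → M.State × (M.Tape → Cell × Move) × Move}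
    (hq : M.final q = false) (hδ : ∀ s b i, M.δ q s b i = sweep q op s (ex s i))
    {V : M.Tape → CellTape} {Q : M.Tape → CellTape → Prop}
    (h : ∀ j, ∃ τ, Sweeps (op j) S B (V j) τ ∧ Q j τ ∧ τ.pos ≤ S) :
    ∃ V' : M.Tape → CellTape, (∀ j, Q j (V' j)) ∧
      Reach w y (Within S p) (B + 1) ⟨q, V, p⟩
        (perform V' p (ex (fun j => (V' j).read) (ChoiceMachine.choiceSymbol y p))) := by
  choose V' hV hQ hS using h
  refine ⟨V', hQ, ?_⟩
  obtain ⟨h1, h2⟩ := reach_swept (w := w) (y := y) (p := p) hq hδ B hV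
  refine h1.trans (Reach.single ⟨rfl, hS⟩ ?_)
  simp [step, hq, out, hδ, sweep, h2]

end CellMachine

/-! ### Representing work tapes -/

/-- The cells `C` represent the work tape `T`: the data track is the tape, cell `0` is recognisable
by its edge track, the cells beyond `e` are recognisable by a blank edge track and are blank on `T`,
and the home track marks the cell `h` (no cell if `h = none`). -/
structure Represents (e : ℕ) (h : Option ℕ) (C : ℕ → Cell) (T : WorkTape) : Prop where
  data : ∀ k, (C k).data = T.cells k
  edge : ∀ k, (C k).edge = if k = 0 then some true else if k ≤ e then some false else none
  home : ∀ k, (C k).home = if h = some k then some true else none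
  blank : ∀ k, e < k → T.cells k = none
  pos_le : T.pos ≤ e + 1

/-- Overwrite the data track of a visited cell, and delete the home mark. -/
def Cell.write (c : Cell) (s : Option Bool) : Cell :=
  ⟨s, if c.edge = none then some false else c.edge, c.count, none⟩

theorem Move.apply_le (m : Move) (p : ℕ) : m.apply p ≤ p + 1 := by
  cases m <;> simp only [Move.apply] <;> omega

namespace Represents

variable {e : ℕ} {h : Option ℕ} {C C' : ℕ → Cell} {T : WorkTape}

theorem edge_eq_true_iff (H : Represents e h C T) (k : ℕ) :
    (C k).edge = some true ↔ k = 0 := by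
  rw [H.edge]; split_ifs <;> simp_all

theorem edge_eq_none_iff (H : Represents e h C T) (k : ℕ) :
    (C k).edge = none ↔ e < k := by
  rw [H.edge]; split_ifs <;> simp_all

theorem congr (H : Represents e h C T)
    (hC : ∀ k, (C' k).data = (C k).data ∧ (C' k).edge = (C k).edge ∧ (C' k).home = (C k).home) :
    Represents e h C' T where
  data k := by rw [(hC k).1, H.data]
  edge k := by rw [(hC k).2.1, H.edge]
  home k := by rw [(hC k).2.2, H.home]
  blank := H.blank
  pos_le := H.pos_le

/-- An action on the represented tape is mirrored by `Cell.write`. It deletes the home mark, so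
the mark has to be below the head, if there is one. -/
theorem act (H : Represents e h C T) (hh : h = none ∨ h = some T.pos) (s : Option Bool)
    (m : Move) :
    Represents (max e T.pos) none (Function.update C T.pos ((C T.pos).write s)) (T.act s m) where
  data k := by
    by_cases hk : k = T.pos
    · subst hk; simp [WorkTape.act, Cell.write]
    · simp [WorkTape.act, hk, H.data]
  edge k := by
    have := H.pos_le
    by_cases hk : k = T.pos
    · subst hk
      simp only [Function.update_self, Cell.write, H.edge]
      split_ifs <;> simp_all
    · rw [Function.update_of_ne hk, H.edge]
      split_ifs <;> first | rfl | omega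
  home k := by
    by_cases hk : k = T.pos
    · subst hk; simp [Cell.write]
    · rw [Function.update_of_ne hk, H.home]
      rcases hh with rfl | rfl
      · simp
      · simp [Ne.symm hk]
  blank k hk := by
    simp only [WorkTape.act]
    rw [Function.update_of_ne (by omega), H.blank k (by omega)]
  pos_le := by
    have := m.apply_le T.pos
    simp only [WorkTape.act]
    omega

end Represents

/-- The tape `τ` represents the work tape `T`, with the head in the right position, and only cells
below `S` have been written. -/
def Stores (S : ℕ) (τ : CellTape) (T : WorkTape) : Prop :=
  ∃ e < S, Represents e none τ.cells T ∧ τ.pos = T.pos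

namespace Stores

variable {S : ℕ} {τ : CellTape} {T : WorkTape}

theorem pos_le (H : Stores S τ T) : τ.pos ≤ S := by
  obtain ⟨e, he, H, hp⟩ := H
  have := H.pos_le
  omega

theorem read_data (H : Stores S τ T) : τ.read.data = T.read := by
  obtain ⟨e, he, H, hp⟩ := H
  rw [CellTape.read, H.data, hp, WorkTape.read]

theorem value_data (H : Stores S τ T) : (τ.track .data).value = T.value := by
  obtain ⟨e, he, H, hp⟩ := H
  simp only [WorkTape.value, CellTape.track, Cell.get, H.data]

theorem act (H : Stores S τ T) (hT : T.pos < S) (s : Option Bool) (m : Move) :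
    Stores S (τ.act (τ.read.write s) m) (T.act s m) := by
  obtain ⟨e, he, H, hp⟩ := H
  refine ⟨max e T.pos, by omega, ?_, ?_⟩
  · simpa [CellTape.act, CellTape.read, hp] using H.act (.inl rfl) s m
  · simp [CellTape.act, WorkTape.act, hp]

end Stores

/-! ### The binary counter -/

/-- The binary number on the count track of the cells `0, …, e`. -/
def countValue (e : ℕ) (C : ℕ → Cell) : ℕ :=
  ∑ k ∈ Finset.range (e + 1), if (C k).count = some true then 2 ^ k else 0

theorem WorkTape.value_eq_sum {T : WorkTape} {e : ℕ} (h : ∀ k, e < k → T.cells k = none) :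
    T.value = ∑ k ∈ Finset.range (e + 1), if T.cells k = some true then 2 ^ k else 0 := by
  refine finsum_eq_sum_of_support_subset _ fun k hk => ?_
  by_contra hk'
  simp only [Finset.coe_range, Set.mem_Iio, not_lt] at hk'
  simp [h k (by omega)] at hk

theorem countValue_eq_zero {e : ℕ} {C : ℕ → Cell} (h : ∀ k ≤ e, (C k).count ≠ some true) :
    countValue e C = 0 :=
  Finset.sum_eq_zero fun k hk => if_neg (h k (by simpa [Nat.lt_succ_iff] using hk))

/-- Binary decrement: the lowest digit `1` becomes `0`, the digits below it become `1`. -/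
theorem countValue_eq_succ {e d : ℕ} {C C' : ℕ → Cell} (hde : d ≤ e)
    (hlow : ∀ k < d, (C k).count ≠ some true ∧ (C' k).count = some true)
    (hd : (C d).count = some true ∧ (C' d).count ≠ some true)
    (hhigh : ∀ k, d < k → (C' k).count = (C k).count) :
    countValue e C = countValue e C' + 1 := by
  unfold countValue
  induction e, hde using Nat.le_induction with
  | base =>
    rw [Finset.sum_range_succ, Finset.sum_range_succ, if_pos hd.1, if_neg hd.2,
      Finset.sum_eq_zero fun k hk => if_neg (hlow k (Finset.mem_range.1 hk)).1,
      Finset.sum_congr rfl fun k hk => if_pos (hlow k (Finset.mem_range.1 hk)).2]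
    have := Nat.geomSum_eq (le_refl 2) d
    have := Nat.one_le_two_pow (n := d)
    simp_all
  | succ n hn ih =>
    rw [Finset.sum_range_succ, ih, Finset.sum_range_succ _ (n + 1), hhigh _ (by omega)]
    omega

/-! ### The composition of an oracle machine and a choice machine -/

/-- The states of the composition of an oracle machine with state space `Q` and a choice machine
with state space `Q'`. The components `q : Q'` and `r : Q` are the current states of the
simulated machines. -/
inductive CompState (Q Q' : Type) where
  /-- mark the left ends of all tapes -/
  | init
  /-- begin of a step of the choice machine: mark the head position on its random access tape -/
  | top (q : Q')
  /-- move to the left ends -/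
  | back (q : Q')
  /-- move to the right, loading the counter and erasing the tapes of the oracle machine -/
  | load (q : Q')
  /-- move to the left ends again -/
  | rewind (q : Q')
  /-- a step of the oracle machine -/
  | sim (q : Q') (r : Q)
  /-- decrement the counter, the oracle machine having written the bit `b` -/
  | dec (q : Q') (r : Q) (b : Bool)
  /-- return to the left end of the counter -/
  | rew (q : Q') (r : Q)
  /-- return to the marked head position and make a step of the choice machine,
  the input bit being `a` -/
  | ret (q : Q') (a : Option Bool)

namespace CompState

instance {Q Q' : Type} [Finite Q] [Finite Q'] : Finite (CompState Q Q') :=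
  Finite.of_injective (β := Fin 9 × Option Q' × Option Q × Option (Option Bool))
    (fun
      | init => (0, none, none, none)
      | top q => (1, some q, none, none)
      | back q => (2, some q, none, none)
      | load q => (3, some q, none, none)
      | rewind q => (4, some q, none, none)
      | sim q r => (5, some q, some r, none)
      | dec q r b => (6, some q, some r, some (some b))
      | rew q r => (7, some q, some r, none)
      | ret q a => (8, some q, none, some a))
    (by rintro (_ | _ | _ | _ | _ | _ | _ | _ | _) (_ | _ | _ | _ | _ | _ | _ | _ | _) h <;>
          simp_all)

end CompState

/-- The program that does nothing. -/
def idle : HeadOp := fun _ => none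

/-- Move to the left end. -/
noncomputable def toEdge : HeadOp := goLeft fun c => c.edge = some true

/-- Apply `f` to all cells up to the last visited one. -/
noncomputable def toEnd (f : Cell → Cell) : HeadOp := goRight (fun c => c.edge = none) f

/-- Turn digits `0` of the counter into `1` up to the first `1`. -/
noncomputable def borrow : HeadOp :=
  goRight (fun c => c.edge = none ∨ c.count = some true) fun c => { c with count := some true }

/-- Move to the marked cell. The simulation of the oracle machine ends at the left end
of the counter if it gives no bit (`none`), and at its right end if it gives one. -/
noncomputable def toHome : Option Bool → HeadOp
  | none => goRight (fun c => c.home = some true) id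
  | some _ => goLeft fun c => c.home = some true

open Classical in
/-- The program `opR` on the tapes of the oracle machine, and the program `opN` on the random access
tape of the choice machine. -/
noncomputable def headOps (R : OracleMachine) (N : ChoiceMachine) (opR opN : HeadOp) :
    Machine.Tape R ⊕ N.Tape → HeadOp :=
  Sum.elim (fun _ => opR) fun j => if j = N.ra then opN else idle

/-- Leave all cells and heads unchanged. -/
def keep {J : Type} (s : J → Cell) : J → Cell × Move := fun j => (s j, .stay)

open Classical in
/-- The transition function of the composition. -/
noncomputable def composeδ (R : OracleMachine) (N : ChoiceMachine) :
    CompState (Machine.State R) N.State → (Machine.Tape R ⊕ N.Tape → Cell) → Option Bool →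
      Option Bool → CompState (Machine.State R) N.State ×
        (Machine.Tape R ⊕ N.Tape → Cell × Move) × Move
  | .init, s, _, _ =>
    (.top N.start, fun j => ({ s j with edge := some true }, .stay), .stay)
  | .top q, s, _, _ =>
    (.back q,
      fun j => (if j = .inr N.ra then { s j with home := some true } else s j, .stay), .stay)
  | .back q, s, _, _ =>
    sweep (.back q) (headOps R N toEdge toEdge) s (.load q, keep s, .stay)
  | .load q, s, _, _ =>
    sweep (.load q) (headOps R N (toEnd fun c => { c with data := none })
      (toEnd fun c => { c with count := c.data })) s (.rewind q, keep s, .stay)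
  | .rewind q, s, _, _ =>
    sweep (.rewind q) (headOps R N toEdge toEdge) s (.sim q (Machine.start R), keep s, .stay)
  | .sim q r, s, b, _ =>
    if Machine.final R r then (.ret q none, keep s, .stay)
    else
      ((Machine.δ R r (fun j => (s (.inl j)).data) b ()).2.2.elim
          (.sim q (Machine.δ R r (fun j => (s (.inl j)).data) b ()).1)
          (.dec q (Machine.δ R r (fun j => (s (.inl j)).data) b ()).1),
        Sum.elim
          (fun j => ((s (.inl j)).write
              ((Machine.δ R r (fun j => (s (.inl j)).data) b ()).2.1 j).1,
            ((Machine.δ R r (fun j => (s (.inl j)).data) b ()).2.1 j).2))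
          (fun j => (s (.inr j), .stay)),
        .stay)
  | .dec q r b, s, _, _ =>
    sweep (.dec q r b) (headOps R N idle borrow) s
      (if (s (.inr N.ra)).edge = none then .ret q (some b) else .rew q r,
        fun j => (if j = .inr N.ra then { s j with count := some false } else s j, .stay), .stay)
  | .rew q r, s, _, _ =>
    sweep (.rew q r) (headOps R N idle toEdge) s (.sim q r, keep s, .stay)
  | .ret q a, s, _, i =>
    sweep (.ret q a) (headOps R N idle (toHome a)) s
      (.top (N.δ q (fun j => (s (.inr j)).data) a i).1,
        Sum.elim (fun j => (s (.inl j), .stay))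
          (fun j => ((s (.inr j)).write ((N.δ q (fun j => (s (.inr j)).data) a i).2.1 j).1,
            ((N.δ q (fun j => (s (.inr j)).data) a i).2.1 j).2)),
        (N.δ q (fun j => (s (.inr j)).data) a i).2.2)

/-- The machine that simulates the choice machine `N` on the query of the oracle machine `R`.
The query is not stored: whenever `N` makes a step, its input bit is found by running `R` from the start,
with a counter for the bits of the query that are still to be skipped. -/
noncomputable abbrev compose (R : OracleMachine) (N : ChoiceMachine) : CellMachine where
  State := CompState (Machine.State R) N.State
  Tape := Machine.Tape R ⊕ N.Tape
  finite_state := by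
    have := Machine.finite_state R
    have := N.finite_state
    infer_instance
  finite_tape := by
    have := Machine.finite_tape R
    have := N.finite_tape
    infer_instance
  ra := .inl (Machine.ra R)
  start := .init
  final
    | .top q => N.final q
    | _ => false
  accepting
    | .top q => N.accepting q
    | _ => false
  δ := composeδ R N

/-! ### Runs of the composition -/

namespace compose

open CellMachine

variable {R : OracleMachine} {N : ChoiceMachine} {w : List Bool} {y : ℕ → Bool} {S cp : ℕ}

theorem perform_keep {M : CellMachine} (V : M.Tape → CellTape) (p : ℕ) (q : M.State) :
    perform V p (q, keep fun j => (V j).read, .stay) = ⟨q, V, p⟩ := by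
  simp [perform, keep, CellTape.act_read_stay, Move.apply]

theorem sweeps_idle {B : ℕ} {τ : CellTape} (h : τ.pos ≤ S) : Sweeps idle S B τ τ :=
  .done rfl h

theorem sweeps_toEdge {e : ℕ} {h : Option ℕ} {τ : CellTape} {T : WorkTape}
    (H : Represents e h τ.cells T) (hp : τ.pos ≤ S) :
    Sweeps toEdge S S τ ⟨τ.cells, 0⟩ := by
  have := sweeps_goLeft (target := fun c => c.edge = some true) (C := τ.cells) (S := S) (p := 0)
    (by simp [H.edge_eq_true_iff]) τ.pos
    (fun k hk _ => by rw [H.edge_eq_true_iff]; omega) (by omega)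
  rw [zero_add] at this
  exact this.mono hp

theorem sweeps_toEnd {e : ℕ} {h : Option ℕ} {τ : CellTape} {T : WorkTape} (f : Cell → Cell)
    (H : Represents e h τ.cells T) (hp : τ.pos = 0) (he : e < S) :
    Sweeps (toEnd f) S S τ ⟨fun k => if k < e + 1 then f (τ.cells k) else τ.cells k, e + 1⟩ := by
  have := sweeps_goRight (target := fun c => c.edge = none) (f := f) (S := S) (e + 1)
    (C := τ.cells) (p := 0) (by simp [H.edge_eq_none_iff])
    (fun k _ hk => by rw [H.edge_eq_none_iff]; omega) (by omega)
  obtain ⟨C, p⟩ := τ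
  obtain rfl : p = 0 := hp
  simp only [zero_add, Nat.zero_le, true_and] at this
  exact this.mono he

open Classical in
/-- A state in which the tapes are swept, followed by its exit step. -/
theorem reach_phase {q : CompState (Machine.State R) N.State} {opR opN : HeadOp}
    {ex : (Machine.Tape R ⊕ N.Tape → Cell) → Option Bool → CompState (Machine.State R) N.State ×
      (Machine.Tape R ⊕ N.Tape → Cell × Move) × Move}
    (hq : (compose R N).final q = false)
    (hδ : ∀ s b i, composeδ R N q s b i = sweep q (headOps R N opR opN) s (ex s i))
    {V : Machine.Tape R ⊕ N.Tape → CellTape} {QR : Machine.Tape R → CellTape → Prop}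
    {τ : CellTape}
    (hR : ∀ j, ∃ τ, Sweeps opR S S (V (.inl j)) τ ∧ QR j τ ∧ τ.pos ≤ S)
    (hN : Sweeps opN S S (V (.inr N.ra)) τ) (hτ : τ.pos ≤ S)
    (hV : ∀ j, j ≠ N.ra → (V (.inr j)).pos ≤ S) :
    ∃ V' : Machine.Tape R ⊕ N.Tape → CellTape, (∀ j, QR j (V' (.inl j))) ∧
      V' (.inr N.ra) = τ ∧ (∀ j, j ≠ N.ra → V' (.inr j) = V (.inr j)) ∧
      Reach (M := compose R N) w y (Within S cp) (S + 1) ⟨q, V, cp⟩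
        (perform (M := compose R N) V' cp
          (ex (fun j => (V' j).read) (ChoiceMachine.choiceSymbol y cp))) := by
  obtain ⟨V', hQ, h⟩ := reach_sweep (M := compose R N) (w := w) (y := y) (S := S) (p := cp) (B := S)
    (op := headOps R N opR opN) (ex := ex) (V := V)
    (Q := Sum.elim QR fun j τ' => if j = N.ra then τ' = τ else τ' = V (.inr j)) hq hδ (by
      rintro (j | j)
      · exact hR j
      · by_cases hj : j = N.ra
        · subst hj
          exact ⟨τ, by simpa [headOps] using hN, by simp, hτ⟩
        · exact ⟨V (.inr j), by simpa [headOps, hj] using sweeps_idle (hV j hj), by simp [hj],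
            hV j hj⟩)
  refine ⟨V', fun j => hQ (.inl j), by simpa using hQ (.inr N.ra), fun j hj => ?_, h⟩
  simpa [hj] using hQ (.inr j)

/-- The tapes of `N` during the search for the input bit: they represent `T`, except that the head of
the random access tape is in cell `p` and its right position is marked;
`e` is the last visited cell of that tape and `n` the value of the counter. -/
structure Inner (R : OracleMachine) {N : ChoiceMachine} (S : ℕ) (T : N.Tape → WorkTape)
    (e n p : ℕ) (V : Machine.Tape R ⊕ N.Tape → CellTape) : Prop where
  lt : e < S
  other : ∀ j, j ≠ N.ra → Stores S (V (.inr j)) (T j)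
  rep : Represents e (some (T N.ra).pos) (V (.inr N.ra)).cells (T N.ra)
  pos : (V (.inr N.ra)).pos = p
  count : countValue e (V (.inr N.ra)).cells = n

variable {T : N.Tape → WorkTape} {V : Machine.Tape R ⊕ N.Tape → CellTape} {e n p : ℕ}

theorem Inner.other_pos_le (H : Inner R S T e n p V) (j : N.Tape) (hj : j ≠ N.ra) :
    (V (.inr j)).pos ≤ S := (H.other j hj).pos_le

theorem Inner.within (H : Inner R S T e n p V) (hp : p ≤ S)
    (hR : ∀ j, (V (.inl j)).pos ≤ S) (q : CompState (Machine.State R) N.State) :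
    Within (M := compose R N) S cp ⟨q, V, cp⟩ := by
  refine ⟨rfl, ?_⟩
  rintro (j | j)
  · exact hR j
  · by_cases hj : j = N.ra
    · subst hj; exact H.pos.trans_le hp
    · exact H.other_pos_le j hj

/-- Moves of the head of the counter, and changes of the counter, keep the tapes of `N`. -/
theorem Inner.of_eq (H : Inner R S T e n p V) {V' : Machine.Tape R ⊕ N.Tape → CellTape}
    {C' : ℕ → Cell} {p' : ℕ} (hra : V' (.inr N.ra) = ⟨C', p'⟩)
    (hV : ∀ j, j ≠ N.ra → V' (.inr j) = V (.inr j))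
    (hC : ∀ k, (C' k).data = ((V (.inr N.ra)).cells k).data ∧
      (C' k).edge = ((V (.inr N.ra)).cells k).edge ∧
      (C' k).home = ((V (.inr N.ra)).cells k).home) :
    Inner R S T e (countValue e C') p' V' where
  lt := H.lt
  other j hj := by rw [hV j hj]; exact H.other j hj
  rep := by rw [hra]; exact H.rep.congr hC
  pos := by rw [hra]
  count := by rw [hra]

open Classical in
/-- The head position on the random access tape of `N` gets marked. -/
theorem reach_top {q : N.State} (hq : N.final q = false)
    (hN : ∀ j, Stores S (V (.inr j)) (T j)) (hR : ∀ j, (V (.inl j)).pos ≤ S) :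
    ∃ V' e n p, p ≤ S ∧ Inner R S T e n p V' ∧ (∀ j, V' (.inl j) = V (.inl j)) ∧
      Reach (M := compose R N) w y (Within S cp) 1 ⟨.top q, V, cp⟩ ⟨.back q, V', cp⟩ := by
  obtain ⟨e, he, hrep, hpos⟩ := hN N.ra
  refine ⟨fun j => (V j).act
    (if j = .inr N.ra then { (V j).read with home := some true } else (V j).read) .stay,
    e, _, (T N.ra).pos, by have := hrep.pos_le; omega, ⟨he, fun j hj => ?_, ?_, ?_, rfl⟩,
    fun j => by simp [CellTape.act_read_stay],
    Reach.single ⟨rfl, ?_⟩ ?_⟩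
  · simpa [hj, CellTape.act_read_stay] using hN j
  · simp only [CellTape.act, if_true, CellTape.read, hpos]
    refine ⟨fun k => ?_, fun k => ?_, fun k => ?_, hrep.blank, hrep.pos_le⟩ <;>
      by_cases hk : k = (T N.ra).pos
    · subst hk; simp [hrep.data]
    · simp [hk, hrep.data]
    · subst hk; simp [hrep.edge]
    · simp [hk, hrep.edge]
    · subst hk; simp
    · simp [hk, hrep.home, Ne.symm hk]
  · simpa [CellTape.act, Move.apply] using hpos
  · rintro (j | j)
    · exact hR j
    · exact (hN j).pos_le
  · simp [step, hq, out, perform, composeδ, Move.apply]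

theorem reach_back {q : N.State} (H : Inner R S T e n p V) (hp : p ≤ S)
    (hR : ∀ j, ∃ U, Stores S (V (.inl j)) U) :
    ∃ V' n, Inner R S T e n 0 V' ∧
      (∀ j, ∃ U, ∃ e < S, Represents e none (V' (.inl j)).cells U ∧ (V' (.inl j)).pos = 0) ∧
      Reach (M := compose R N) w y (Within S cp) (S + 1) ⟨.back q, V, cp⟩ ⟨.load q, V', cp⟩ := by
  obtain ⟨V', h1, h2, h3, h4⟩ := reach_phase (R := R) (N := N) (q := .back q) (w := w) (y := y)
    (cp := cp) (V := V) (τ := ⟨(V (.inr N.ra)).cells, 0⟩)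
    (QR := fun _ τ => ∃ U, ∃ e < S, Represents e none τ.cells U ∧ τ.pos = 0) rfl
    (fun _ _ _ => rfl) (fun j => by
      obtain ⟨U, hU⟩ := hR j
      have hU' := hU
      obtain ⟨e, he, hrep, hpos⟩ := hU'
      exact ⟨_, sweeps_toEdge hrep hU.pos_le, ⟨U, e, he, hrep, rfl⟩, Nat.zero_le _⟩)
    (sweeps_toEdge H.rep (H.pos.trans_le hp)) (Nat.zero_le _) H.other_pos_le
  rw [perform_keep] at h4
  exact ⟨V', _, H.of_eq h2 h3 fun k => ⟨rfl, rfl, rfl⟩, h1, h4⟩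

/-- The counter is loaded with the number on the random access tape of `N`, and the tapes of `R`
are erased. The cells erased remain marked as visited. -/
theorem reach_load {q : N.State} (H : Inner R S T e n 0 V)
    (hR : ∀ j, ∃ U, ∃ e < S, Represents e none (V (.inl j)).cells U ∧ (V (.inl j)).pos = 0) :
    ∃ V', Inner R S T e (T N.ra).value (e + 1) V' ∧
      (∀ j, ∃ e < S, Represents e none (V' (.inl j)).cells WorkTape.blank ∧
        (V' (.inl j)).pos ≤ S) ∧
      Reach (M := compose R N) w y (Within S cp) (S + 1) ⟨.load q, V, cp⟩
        ⟨.rewind q, V', cp⟩ := by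
  obtain ⟨V', h1, h2, h3, h4⟩ := reach_phase (R := R) (N := N) (q := .load q) (w := w) (y := y)
    (cp := cp) (V := V)
    (QR := fun _ τ => ∃ e < S, Represents e none τ.cells WorkTape.blank ∧ τ.pos ≤ S) rfl
    (fun _ _ _ => rfl) (fun j => by
      obtain ⟨U, e, he, hrep, hpos⟩ := hR j
      refine ⟨_, sweeps_toEnd _ hrep hpos he, ⟨e, he, ⟨fun k => ?_, fun k => ?_, fun k => ?_,
        fun _ _ => rfl, Nat.zero_le _⟩, by simpa using he⟩, by simpa using he⟩
      · by_cases hk : k < e + 1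
        · simp [hk, WorkTape.blank]
        · simp [hk, WorkTape.blank, hrep.data, hrep.blank k (by omega)]
      · rw [← hrep.edge]; dsimp only; split_ifs <;> rfl
      · rw [← hrep.home]; dsimp only; split_ifs <;> rfl)
    (sweeps_toEnd _ H.rep H.pos H.lt) (by simpa using H.lt) H.other_pos_le
  rw [perform_keep] at h4
  refine ⟨V', ?_, h1, h4⟩
  convert H.of_eq h2 h3 fun k => ?_ using 1
  · rw [WorkTape.value_eq_sum H.rep.blank, countValue]
    refine Finset.sum_congr rfl fun k hk => ?_
    simp only [if_pos (Finset.mem_range.1 hk), H.rep.data]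
  · split_ifs <;> exact ⟨rfl, rfl, rfl⟩

theorem reach_rewind {q : N.State} (H : Inner R S T e n (e + 1) V)
    (hR : ∀ j, ∃ e < S, Represents e none (V (.inl j)).cells WorkTape.blank ∧
        (V (.inl j)).pos ≤ S) :
    ∃ V', Inner R S T e n 0 V' ∧ (∀ j, Stores S (V' (.inl j)) WorkTape.blank) ∧
      Reach (M := compose R N) w y (Within S cp) (S + 1) ⟨.rewind q, V, cp⟩
        ⟨.sim q (Machine.start R), V', cp⟩ := by
  obtain ⟨V', h1, h2, h3, h4⟩ := reach_phase (R := R) (N := N) (q := .rewind q) (w := w) (y := y)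
    (cp := cp) (V := V) (τ := ⟨(V (.inr N.ra)).cells, 0⟩)
    (QR := fun _ τ => Stores S τ WorkTape.blank) rfl
    (fun _ _ _ => rfl) (fun j => by
      obtain ⟨e, he, hrep, hpos⟩ := hR j
      exact ⟨_, sweeps_toEdge hrep hpos, ⟨e, he, hrep, rfl⟩, Nat.zero_le _⟩)
    (sweeps_toEdge H.rep (H.pos.trans_le H.lt)) (Nat.zero_le _) H.other_pos_le
  rw [perform_keep] at h4
  refine ⟨V', ?_, h1, h4⟩
  have := H.of_eq h2 h3 fun k => ⟨rfl, rfl, rfl⟩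
  rwa [H.count] at this

/-- A step of the oracle machine. -/
theorem reach_sim {q : N.State} {c : OracleMachine.Config R} (H : Inner R S T e n 0 V)
    (hR : ∀ j, Stores S (V (.inl j)) (c.core.tapes j)) (hS : ∀ j, (c.core.tapes j).pos < S)
    (hc : Machine.final R c.core.state = false) :
    ∃ V', Inner R S T e n 0 V' ∧
      (∀ j, Stores S (V' (.inl j)) ((OracleMachine.step R w c).core.tapes j)) ∧
      Reach (M := compose R N) w y (Within S cp) 1 ⟨.sim q c.core.state, V, cp⟩
        ⟨(Machine.trans R w c.core ()).2.2.elim (.sim q (OracleMachine.step R w c).core.state)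
          (.dec q (OracleMachine.step R w c).core.state), V', cp⟩ := by
  have hδ : (Machine.δ R c.core.state (fun j => (V (.inl j)).read.data)
      (w[((V (.inl (Machine.ra R))).track .data).value]?) ()) = Machine.trans R w c.core () := by
    simp only [(hR _).read_data, (hR _).value_data, Machine.trans]
  refine ⟨Sum.elim (fun j => (V (.inl j)).act ((V (.inl j)).read.write
    ((Machine.trans R w c.core ()).2.1 j).1) ((Machine.trans R w c.core ()).2.1 j).2)
    fun j => V (.inr j), ⟨H.lt, H.other, H.rep, H.pos, H.count⟩, fun j => ?_,
    Reach.single (H.within (Nat.zero_le _) (fun j => (hR j).pos_le) _) ?_⟩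
  · simp only [Sum.elim_inl, OracleMachine.step, hc, Machine.next]
    exact (hR j).act (hS j) _ _
  · have ho : out (M := compose R N) w y ⟨.sim q c.core.state, V, cp⟩ =
      ((Machine.trans R w c.core ()).2.2.elim (.sim q (Machine.trans R w c.core ()).1)
          (.dec q (Machine.trans R w c.core ()).1),
        Sum.elim
          (fun j => ((V (.inl j)).read.write ((Machine.trans R w c.core ()).2.1 j).1,
            ((Machine.trans R w c.core ()).2.1 j).2))
          (fun j => ((V (.inr j)).read, .stay)),
        .stay) := by
      simp only [out, compose, composeδ, hc, hδ]
      simp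
    simp only [step, ho, perform, OracleMachine.step, hc, Machine.next]
    simp only [Bool.false_eq_true, if_false, Move.apply, Config.mk.injEq, true_and, and_true]
    funext j
    rcases j with j | j
    · rfl
    · exact CellTape.act_read_stay _

/-- The oracle machine has halted. -/
theorem reach_sim_final {q : N.State} {r : Machine.State R} (H : Inner R S T e n 0 V)
    (hR : ∀ j, (V (.inl j)).pos ≤ S) (hc : Machine.final R r = true) :
    Reach (M := compose R N) w y (Within S cp) 1 ⟨.sim q r, V, cp⟩ ⟨.ret q none, V, cp⟩ := by
  refine Reach.single (H.within (Nat.zero_le _) hR _) ?_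
  simp only [step, out, composeδ, hc, Bool.false_eq_true, if_false, if_true]
  exact perform_keep (M := compose R N) V cp _

open Classical in
/-- The counter is `0` and the current bit of the query is the desired one, or the counter
is decremented. -/
theorem reach_dec {q : N.State} {r : Machine.State R} {b : Bool} (H : Inner R S T e n 0 V)
    (hR : ∀ j, (V (.inl j)).pos ≤ S) :
    (n = 0 ∧ ∃ V' n', Inner R S T e n' (e + 1) V' ∧ (∀ j, V' (.inl j) = V (.inl j)) ∧
      Reach (M := compose R N) w y (Within S cp) (S + 1) ⟨.dec q r b, V, cp⟩
        ⟨.ret q (some b), V', cp⟩) ∨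
    ∃ m, n = m + 1 ∧ ∃ V' d, d ≤ e ∧ Inner R S T e m d V' ∧ (∀ j, V' (.inl j) = V (.inl j)) ∧
      Reach (M := compose R N) w y (Within S cp) (S + 1) ⟨.dec q r b, V, cp⟩
        ⟨.rew q r, V', cp⟩ := by
  have he := H.lt
  set C := (V (.inr N.ra)).cells with hC
  -- The sweep stops at the lowest digit `1`, or behind the counter if there is none.
  let target : Cell → Prop := fun c => c.edge = none ∨ c.count = some true
  have hend : target (C (e + 1)) := .inl ((H.rep.edge_eq_none_iff _).2 (by omega))
  obtain ⟨d, htarget, hmin⟩ : ∃ d, target (C d) ∧ ∀ k < d, ¬ target (C k) :=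
    let hex : ∃ k, target (C k) := ⟨_, hend⟩
    ⟨Nat.find hex, Nat.find_spec hex, fun _ hk => Nat.find_min hex hk⟩
  have hde : d ≤ e + 1 := not_lt.1 fun h => hmin _ h hend
  have hsw : Sweeps borrow S S (V (.inr N.ra))
      ⟨fun k => if k < d then { C k with count := some true } else C k, d⟩ := by
    have := sweeps_goRight (target := target) (f := fun c => { c with count := some true }) (S := S) d
      (C := C) (p := 0) (by rwa [zero_add]) (fun k _ hk => hmin k (by omega)) (by omega)
    simp only [zero_add, Nat.zero_le, true_and] at this
    have hV : V (.inr N.ra) = ⟨C, 0⟩ := by rw [hC, ← H.pos]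
    rw [hV]
    exact this.mono (by omega)
  obtain ⟨V', h1, h2, h3, h4⟩ := reach_phase (R := R) (N := N) (q := .dec q r b) (w := w) (y := y)
    (cp := cp) (V := V) (QR := fun j τ => τ = V (.inl j)) rfl
    (fun _ _ _ => rfl) (fun j => ⟨_, sweeps_idle (hR j), rfl, hR j⟩) hsw (by dsimp only; omega)
    H.other_pos_le
  set V'' : Machine.Tape R ⊕ N.Tape → CellTape := fun j => (V' j).act
    (if j = .inr N.ra then { (V' j).read with count := some false } else (V' j).read) .stay with hV''
  set C' : ℕ → Cell := Function.update
    (fun k => if k < d then { C k with count := some true } else C k) d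
    { C d with count := some false } with hC'
  have hlow : ∀ k, k < d → C' k = { C k with count := some true } := fun k hk => by
    rw [hC', Function.update_of_ne (by omega), if_pos hk]
  have hmid : C' d = { C d with count := some false } := by rw [hC', Function.update_self]
  have hhigh : ∀ k, d < k → C' k = C k := fun k hk => by
    rw [hC', Function.update_of_ne (by omega), if_neg (by omega)]
  have hra : V'' (.inr N.ra) = ⟨C', d⟩ := by
    simp [hV'', h2, CellTape.act, CellTape.read, Move.apply, hC']
  have hR' : ∀ j, V'' (.inl j) = V (.inl j) := fun j => by
    simp [hV'', h1, CellTape.act_read_stay]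
  have hin : Inner R S T e (countValue e C') d V'' := by
    refine H.of_eq hra (fun j hj => ?_) fun k => ?_
    · simp [hV'', hj, h3, CellTape.act_read_stay]
    · rcases lt_trichotomy k d with hk | rfl | hk
      · rw [hlow k hk]; exact ⟨rfl, rfl, rfl⟩
      · rw [hmid]; exact ⟨rfl, rfl, rfl⟩
      · rw [hhigh k hk]; exact ⟨rfl, rfl, rfl⟩
  have h5 : Reach (M := compose R N) w y (Within S cp) (S + 1) ⟨.dec q r b, V, cp⟩
      ⟨if (V' (.inr N.ra)).read.edge = none then .ret q (some b) else .rew q r, V'', cp⟩ := h4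
  have hedge : (V' (.inr N.ra)).read.edge = none ↔ e < d := by
    rw [← H.rep.edge_eq_none_iff d]
    simp [h2, CellTape.read, hC]
  -- Behind the counter (`e < d`) it has been `0`, otherwise the digit in cell `d` is cleared.
  by_cases hdd : e < d
  · obtain rfl : d = e + 1 := by omega
    refine .inl ⟨?_, V'', _, hin, hR', by simpa only [hedge, hdd, if_true] using h5⟩
    rw [← H.count]
    exact countValue_eq_zero fun k hk h => hmin k (by omega) (.inr h)
  · refine .inr ⟨countValue e C', ?_, V'', d, by omega, hin, hR',
      by simpa only [hedge, hdd, if_false] using h5⟩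
    rw [← H.count]
    refine countValue_eq_succ (d := d) (by omega) (fun k hk => ⟨fun h => hmin k hk (.inr h), ?_⟩)
      ⟨htarget.resolve_left fun h => hdd ((H.rep.edge_eq_none_iff d).1 h), ?_⟩ fun k hk => ?_
    · rw [hlow k hk]
    · rw [hmid]; simp
    · rw [hhigh k hk]

theorem reach_rew {q : N.State} {r : Machine.State R} (H : Inner R S T e n p V) (hp : p ≤ S)
    (hR : ∀ j, (V (.inl j)).pos ≤ S) :
    ∃ V', Inner R S T e n 0 V' ∧ (∀ j, V' (.inl j) = V (.inl j)) ∧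
      Reach (M := compose R N) w y (Within S cp) (S + 1) ⟨.rew q r, V, cp⟩ ⟨.sim q r, V', cp⟩ := by
  obtain ⟨V', h1, h2, h3, h4⟩ := reach_phase (R := R) (N := N) (q := .rew q r) (w := w) (y := y)
    (cp := cp) (V := V) (τ := ⟨(V (.inr N.ra)).cells, 0⟩) (QR := fun j τ => τ = V (.inl j)) rfl
    (fun _ _ _ => rfl) (fun j => ⟨_, sweeps_idle (hR j), rfl, hR j⟩)
    (sweeps_toEdge H.rep (H.pos.trans_le hp)) (Nat.zero_le _) H.other_pos_le
  rw [perform_keep] at h4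
  refine ⟨V', ?_, h1, h4⟩
  have := H.of_eq h2 h3 fun k => ⟨rfl, rfl, rfl⟩
  rwa [H.count] at this

/-- The head of the counter finds the mark, starting from the left end if the simulation of `R` gave
no bit, and from the first unvisited cell if it gave one. -/
theorem sweeps_toHome {a : Option Bool} (H : Inner R S T e n p V)
    (hp : p = if a = none then 0 else e + 1) :
    Sweeps (toHome a) S S (V (.inr N.ra)) ⟨(V (.inr N.ra)).cells, (T N.ra).pos⟩ := by
  have he := H.lt
  have hle := H.rep.pos_le
  have hV : V (.inr N.ra) = ⟨(V (.inr N.ra)).cells, p⟩ := by rw [← H.pos]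
  have hhome : ∀ k, ((V (.inr N.ra)).cells k).home = some true ↔ k = (T N.ra).pos := fun k => by
    rw [H.rep.home]; simp [eq_comm]
  generalize (V (.inr N.ra)).cells = C at hV hhome
  rw [hV]
  cases a with
  | none =>
    obtain rfl : p = 0 := hp
    have := sweeps_goRight (target := fun c => c.home = some true) (f := id) (S := S) (T N.ra).pos
      (C := C) (p := 0) (by simp [hhome]) (fun k _ hk => by rw [hhome]; omega) (by omega)
    simp only [zero_add, id, ite_self] at this
    exact this.mono (by omega)
  | some b =>
    obtain rfl : p = e + 1 := hp
    have := sweeps_goLeft (target := fun c => c.home = some true) (C := C) (S := S)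
      (p := (T N.ra).pos) (by simp [hhome]) (e + 1 - (T N.ra).pos)
      (fun k hk _ => by rw [hhome]; omega) (by omega)
    rw [Nat.add_sub_cancel' hle] at this
    exact this.mono (by omega)

/-- A step of the choice machine. -/
theorem reach_ret {q : N.State} {a : Option Bool} (H : Inner R S T e n p V)
    (hp : p = if a = none then 0 else e + 1) (hT : ∀ j, (T j).pos < S)
    (hR : ∀ j, (V (.inl j)).pos ≤ S)
    {o : N.State × (N.Tape → Option Bool × Move) × Move}
    (ho : o = N.δ q (fun j => (T j).read) a (ChoiceMachine.choiceSymbol y cp)) :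
    ∃ V', (∀ j, Stores S (V' (.inr j)) ((T j).act (o.2.1 j).1 (o.2.1 j).2)) ∧
      (∀ j, V' (.inl j) = V (.inl j)) ∧
      Reach (M := compose R N) w y (Within S cp) (S + 1) ⟨.ret q a, V, cp⟩
        ⟨.top o.1, V', o.2.2.apply cp⟩ := by
  have hle := H.rep.pos_le
  have he := H.lt
  obtain ⟨V', h1, h2, h3, h4⟩ := reach_phase (R := R) (N := N) (q := .ret q a) (w := w) (y := y)
    (cp := cp) (V := V) (QR := fun j τ => τ = V (.inl j)) rfl
    (fun _ _ _ => rfl) (fun j => ⟨_, sweeps_idle (hR j), rfl, hR j⟩)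
    (sweeps_toHome H hp) (by dsimp only; omega) H.other_pos_le
  have hread : (fun j => (V' (.inr j)).read.data) = fun j => (T j).read := by
    funext j
    by_cases hj : j = N.ra
    · subst hj
      rw [h2, CellTape.read, H.rep.data, WorkTape.read]
    · rw [h3 j hj, (H.other j hj).read_data]
  simp only [hread, ← ho] at h4
  refine ⟨_, fun j => ?_, fun j => ?_, h4⟩
  · simp only [Sum.elim_inr]
    by_cases hj : j = N.ra
    · subst hj
      rw [h2]
      exact ⟨max e (T N.ra).pos, by have := hT N.ra; omega, H.rep.act (.inr rfl) _ _, rfl⟩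
    · rw [h3 j hj]
      exact (H.other j hj).act (hT j) _ _
  · simp only [Sum.elim_inl, CellTape.act_read_stay, h1]

end compose

/-! ### Correctness of the simulation -/

/-- An iteration halts in at most one state, if states satisfying `H` are fixed points. -/
theorem iterate_eq_of_halted {α : Type*} {f : α → α} {H : α → Prop} (hf : ∀ x, H x → f x = x)
    {x : α} {s t : ℕ} (hs : H (f^[s] x)) (ht : H (f^[t] x)) : f^[s] x = f^[t] x := by
  rcases le_total s t with h | h
  · obtain ⟨d, rfl⟩ := Nat.exists_eq_add_of_le h
    rw [add_comm, Function.iterate_add_apply, Function.iterate_fixed (hf _ hs)]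
  · obtain ⟨d, rfl⟩ := Nat.exists_eq_add_of_le h
    rw [add_comm, Function.iterate_add_apply, Function.iterate_fixed (hf _ ht)]

theorem iterate_eq_of_le {α : Type*} {f : α → α} {H : α → Prop} (hf : ∀ x, H x → f x = x)
    {x : α} {s t : ℕ} (hs : H (f^[s] x)) (h : s ≤ t) : f^[t] x = f^[s] x := by
  obtain ⟨d, rfl⟩ := Nat.exists_eq_add_of_le h
  rw [add_comm, Function.iterate_add_apply, Function.iterate_fixed (hf _ hs)]

namespace OracleMachine

variable {R : OracleMachine} {w : List Bool}

theorem run_succ (t : ℕ) : run R w (t + 1) = step R w (run R w t) :=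
  Function.iterate_succ_apply' _ _ _

theorem step_of_final (c : Config R) (h : R.final c.core.state = true) : step R w c = c :=
  if_pos h

theorem oracleTape_prefix {s t : ℕ} (h : s ≤ t) :
    (run R w s).oracleTape <+: (run R w t).oracleTape := by
  induction t, h using Nat.le_induction with
  | base => exact List.prefix_rfl
  | succ t _ ih =>
    refine ih.trans ?_
    rw [run_succ, step]
    split_ifs
    · exact List.prefix_rfl
    · exact List.prefix_append _ _

theorem length_oracleTape_le (t : ℕ) : (run R w t).oracleTape.length ≤ t := by
  induction t with
  | zero => simp [run]
  | succ t ih =>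
    rw [run_succ, step]
    split_ifs
    · omega
    · rw [List.length_append]
      have : ∀ o : Option Bool, o.toList.length ≤ 1 := by rintro (_ | _) <;> simp
      have := this (Machine.trans R w (run R w t).core ()).2.2
      omega

end OracleMachine

namespace compose

open CellMachine

variable {R : OracleMachine} {N : ChoiceMachine} {w v : List Bool} {y : ℕ → Bool} {S cp TR : ℕ}
variable {T : N.Tape → WorkTape} {V : Machine.Tape R ⊕ N.Tape → CellTape} {e n p : ℕ}

/-- The simulation of the oracle machine from its step `t` on, with `n` bits still to be skipped,
yields the bit of the query that comes `n` places after those already written. -/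
theorem reach_answer {q : N.State}
    (hS : ∀ t j, ((OracleMachine.run R w t).core.tapes j).pos < S)
    (hfin : R.final (OracleMachine.run R w TR).core.state = true)
    (hv : (OracleMachine.run R w TR).oracleTape = v) (d t : ℕ) (ht : t + d = TR)
    {V : Machine.Tape R ⊕ N.Tape → CellTape} {n : ℕ} (H : Inner R S T e n 0 V)
    (hR : ∀ j, Stores S (V (.inl j)) ((OracleMachine.run R w t).core.tapes j))
    {a : Option Bool} (ha : a = v[(OracleMachine.run R w t).oracleTape.length + n]?) :
    ∃ V' n', Inner R S T e n' (if a = none then 0 else e + 1) V' ∧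
      (∀ j, ∃ U, Stores S (V' (.inl j)) U) ∧
      Reach (M := compose R N) w y (Within S cp) (d * (2 * S + 3) + 1)
        ⟨.sim q (OracleMachine.run R w t).core.state, V, cp⟩ ⟨.ret q a, V', cp⟩ := by
  induction d generalizing t V n with
  | zero =>
    obtain rfl : t = TR := ht
    obtain rfl : a = none := by rw [ha, hv]; simp
    exact ⟨V, n, H, fun j => ⟨_, hR j⟩,
      (reach_sim_final H (fun j => (hR j).pos_le) hfin).mono (by omega)⟩
  | succ d ih =>
    by_cases hc : R.final (OracleMachine.run R w t).core.state = true
    · have hrun : OracleMachine.run R w TR = OracleMachine.run R w t :=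
        iterate_eq_of_le (H := fun c : OracleMachine.Config R => R.final c.core.state = true)
          OracleMachine.step_of_final hc (by omega)
      obtain rfl : a = none := by rw [ha, ← hv, hrun]; simp
      exact ⟨V, n, H, fun j => ⟨_, hR j⟩,
        (reach_sim_final H (fun j => (hR j).pos_le) hc).mono (by omega)⟩
    · have hc' : R.final (OracleMachine.run R w t).core.state = false := by simpa using hc
      obtain ⟨V₁, H₁, hR₁, h₁⟩ := reach_sim (w := w) (y := y) (cp := cp) (q := q) H hR (hS t) hc'
      rw [← OracleMachine.run_succ] at hR₁ h₁
      have htape : (OracleMachine.run R w (t + 1)).oracleTape = (OracleMachine.run R w t).oracleTape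
          ++ (Machine.trans R w (OracleMachine.run R w t).core ()).2.2.toList := by
        rw [OracleMachine.run_succ, OracleMachine.step, if_neg hc]
      cases hb : (Machine.trans R w (OracleMachine.run R w t).core ()).2.2 with
      | none =>
        rw [hb] at h₁ htape
        obtain ⟨V', n', h2, h3, h4⟩ := ih (t + 1) (by omega) H₁ hR₁ (by simpa [htape] using ha)
        exact ⟨V', n', h2, h3, (h₁.trans h4).mono (by linarith)⟩
      | some b =>
        rw [hb] at h₁ htape
        rcases reach_dec (w := w) (y := y) (cp := cp) (q := q)
            (r := (OracleMachine.run R w (t + 1)).core.state) (b := b) H₁ fun j => (hR₁ j).pos_le with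
          ⟨rfl, V₂, n₂, H₂, hR₂, h₂⟩ | ⟨m, rfl, V₂, d₂, hd₂, H₂, hR₂, h₂⟩
        · obtain rfl : a = some b := by
            have hpre := OracleMachine.oracleTape_prefix (R := R) (w := w) (s := t + 1) (t := TR)
              (by omega)
            rw [hv, htape] at hpre
            obtain ⟨u, rfl⟩ := hpre
            rw [ha]
            simp
          refine ⟨V₂, n₂, H₂, fun j => ⟨_, by rw [hR₂]; exact hR₁ j⟩, (h₁.trans h₂).mono ?_⟩
          linarith [Nat.zero_le (d * (2 * S + 3))]
        · have hlt := H₂.lt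
          obtain ⟨V₃, H₃, hR₃, h₃⟩ := reach_rew (w := w) (y := y) (cp := cp) (q := q)
            (r := (OracleMachine.run R w (t + 1)).core.state) H₂ (by omega)
            fun j => by rw [hR₂]; exact (hR₁ j).pos_le
          obtain ⟨V', n', h4, h5, h6⟩ := ih (t + 1) (by omega) H₃
            (fun j => by rw [hR₃, hR₂]; exact hR₁ j) (by rw [ha, htape]; simp; congr 1; omega)
          exact ⟨V', n', h4, h5, (h₁.trans (h₂.trans (h₃.trans h6))).mono (by linarith)⟩

/-- The configuration `C` of the composition represents the configuration `c` of the
choice machine. -/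
def Corresponds (S : ℕ) (c : N.Config) (C : (compose R N).Config) : Prop :=
  C.state = .top c.core.state ∧ C.choicePos = c.choicePos ∧
    (∀ j, Stores S (C.tapes (.inr j)) (c.core.tapes j)) ∧
    ∀ j, ∃ U, Stores S (C.tapes (.inl j)) U

/-- Marking the left ends of the blank tapes yields a representation of the initial configuration. -/
theorem reach_init (hS : 0 < S) : ∃ C : (compose R N).Config,
    Corresponds S ⟨N.init, 0⟩ C ∧
      Reach w y (Within S 0) 1 ⟨CompState.init, fun _ => CellTape.blank, 0⟩ C := by
  have hst : Stores S (CellTape.blank.act { CellTape.blank.read with edge := some true } .stay)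
      WorkTape.blank := by
    refine ⟨0, hS, ⟨fun k => ?_, fun k => ?_, fun k => ?_, fun _ _ => rfl, Nat.zero_le _⟩, rfl⟩ <;>
      rcases k with _ | k <;>
      simp [CellTape.act, CellTape.blank, CellTape.read, WorkTape.blank]
  refine ⟨⟨.top N.start,
    fun _ => CellTape.blank.act { CellTape.blank.read with edge := some true } .stay, 0⟩,
    ⟨rfl, rfl, fun _ => hst, fun _ => ⟨_, hst⟩⟩, Reach.single ⟨rfl, fun _ => Nat.zero_le _⟩ rfl⟩

/-- One step of the choice machine on the query `v` is simulated by the composition on `w`. During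
the simulation the head on the choice tape rests; it moves with the last step. -/
theorem reach_step (hS : ∀ t j, ((OracleMachine.run R w t).core.tapes j).pos < S)
    (hfin : R.final (OracleMachine.run R w TR).core.state = true)
    (hv : (OracleMachine.run R w TR).oracleTape = v) {c : N.Config} {C : (compose R N).Config}
    (hc : N.final c.core.state = false) (hT : ∀ j, (c.core.tapes j).pos < S)
    (hC : Corresponds S c C) :
    ∃ C', Corresponds S (N.step v y c) C' ∧ Reach w y (Within S c.choicePos)
      (TR * (2 * S + 3) + 4 * S + 6) C C' := by
  obtain ⟨q, V, cp⟩ := C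
  obtain ⟨hq, hcp, hN, hR⟩ := hC
  dsimp only at hq hcp hN hR
  subst hq hcp
  obtain ⟨V₁, e, n₁, p₁, hp₁, H₁, hR₁, h₁⟩ := reach_top (w := w) (y := y) (cp := c.choicePos) hc hN
    fun j => (hR j).choose_spec.pos_le
  obtain ⟨V₂, n₂, H₂, hR₂, h₂⟩ := reach_back (w := w) (y := y) (cp := c.choicePos)
    (q := c.core.state) H₁ hp₁ fun j => by rw [hR₁]; exact hR j
  obtain ⟨V₃, H₃, hR₃, h₃⟩ := reach_load (w := w) (y := y) (cp := c.choicePos)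
    (q := c.core.state) H₂ hR₂
  obtain ⟨V₄, H₄, hR₄, h₄⟩ := reach_rewind (w := w) (y := y) (cp := c.choicePos)
    (q := c.core.state) H₃ hR₃
  obtain ⟨V₅, n₅, H₅, hR₅, h₅⟩ := reach_answer (w := w) (y := y) (cp := c.choicePos)
    (q := c.core.state) (a := v[(c.core.tapes N.ra).value]?) hS hfin hv TR 0 (zero_add _) H₄ hR₄
    (by simp [OracleMachine.run])
  obtain ⟨V₆, hN₆, hR₆, h₆⟩ := reach_ret (w := w) (y := y) (cp := c.choicePos) H₅ rfl hT
    (fun j => (hR₅ j).choose_spec.pos_le)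
    (o := N.trans v c.core (ChoiceMachine.choiceSymbol y c.choicePos)) rfl
  have hR₇ : ∀ j, ∃ U, Stores S (V₆ (.inl j)) U := fun j => by rw [hR₆]; exact hR₅ j
  refine ⟨_, ?_, (h₁.trans (h₂.trans (h₃.trans (h₄.trans (h₅.trans h₆))))).mono (by omega)⟩
  rw [ChoiceMachine.step, if_neg (by simp [hc])]
  exact ⟨rfl, rfl, hN₆, hR₇⟩

/-- Every step of the choice machine on the query is simulated within the given time. -/
theorem exists_run (hS : ∀ t j, ((OracleMachine.run R w t).core.tapes j).pos < S)
    (hfin : R.final (OracleMachine.run R w TR).core.state = true)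
    (hv : (OracleMachine.run R w TR).oracleTape = v)
    (hT : ∀ t j, ((N.run v y t).core.tapes j).pos < S) (n : ℕ) :
    ∃ t ≤ n * (TR * (2 * S + 3) + 4 * S + 6) + 1,
      Corresponds S (N.run v y n) ((compose R N).run w y t) ∧
      ∀ s < t, (∀ j, (((compose R N).run w y s).tapes j).pos ≤ S) ∧
        ∃ m, ((compose R N).run w y s).choicePos = (N.run v y m).choicePos := by
  induction n with
  | zero =>
    obtain ⟨C, hC, t, ht, rfl, h⟩ := reach_init (R := R) (N := N) (w := w) (y := y)
      (S := S) ((Nat.zero_le _).trans_lt (hT 0 N.ra))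
    exact ⟨t, by omega, hC, fun s hs => ⟨(h s hs).2, 0, (h s hs).1⟩⟩
  | succ n ih =>
    obtain ⟨t, ht, hC, h⟩ := ih
    have hsucc : N.run v y (n + 1) = N.step v y (N.run v y n) :=
      Function.iterate_succ_apply' _ _ _
    by_cases hc : N.final (N.run v y n).core.state = true
    · refine ⟨t, ht.trans (by linarith [Nat.zero_le (TR * (2 * S + 3))]), ?_, h⟩
      rwa [hsucc, ChoiceMachine.step, if_pos hc]
    · obtain ⟨C', hC', t', ht', rfl, h'⟩ := reach_step (y := y) hS hfin hv (by simpa using hc)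
        (hT n) hC
      have hadd : ∀ s, (step w y)^[s] ((compose R N).run w y t) = (compose R N).run w y (s + t) :=
        fun s => (Function.iterate_add_apply _ _ _ _).symm
      simp only [hadd] at hC' h'
      refine ⟨t' + t, by linarith, hsucc ▸ hC', fun s hs => ?_⟩
      rcases lt_or_ge s t with hst | hst
      · exact h s hst
      · have := h' (s - t) (by omega)
        rw [Nat.sub_add_cancel hst] at this
        exact ⟨this.2, n, this.1⟩

/-- The composition behaves on the word `w` as the choice machine on the query of the oracle
machine. -/
theorem run_spec (hS : ∀ t j, ((OracleMachine.run R w t).core.tapes j).pos < S)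
    (hfin : R.final (OracleMachine.run R w TR).core.state = true)
    (hv : (OracleMachine.run R w TR).oracleTape = v)
    (hT : ∀ t j, ((N.run v y t).core.tapes j).pos < S) {TN : ℕ}
    (hTN : N.final (N.run v y TN).core.state = true) :
    ∃ t₀ ≤ TN * (TR * (2 * S + 3) + 4 * S + 6) + 1,
      ((compose R N).run w y t₀).state = .top (N.run v y TN).core.state ∧
      (∀ t j, (((compose R N).run w y t).tapes j).pos ≤ S) ∧
      (Set.range fun t => ((compose R N).run w y t).choicePos) =
        Set.range fun t => (N.run v y t).choicePos := by
  obtain ⟨t₀, ht₀, ⟨h1, h2, h3, h4⟩, h5⟩ := exists_run hS hfin hv hT TN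
  have hfin₀ : (compose R N).final ((compose R N).run w y t₀).state = true := by
    rw [h1]; exact hTN
  -- Once halted, the composition visits no further choice cells.
  have hrest : ∀ t, t₀ ≤ t → (compose R N).run w y t = (compose R N).run w y t₀ := fun t ht =>
    iterate_eq_of_le (H := fun C : (compose R N).Config => (compose R N).final C.state = true)
      step_of_final hfin₀ ht
  refine ⟨t₀, ht₀, h1, fun t j => ?_, Set.Subset.antisymm ?_ ?_⟩
  · rcases lt_or_ge t t₀ with ht | ht
    · exact (h5 t ht).1 j
    · rw [hrest t ht]
      rcases j with j | j
      · exact (h4 j).choose_spec.pos_le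
      · exact (h3 j).pos_le
  · rintro _ ⟨t, rfl⟩
    rcases lt_or_ge t t₀ with ht | ht
    · obtain ⟨m, hm⟩ := (h5 t ht).2
      exact ⟨m, hm.symm⟩
    · exact ⟨TN, by dsimp only; rw [hrest t ht, h2]⟩
  · rintro _ ⟨n, rfl⟩
    obtain ⟨t, _, hC, _⟩ := exists_run (w := w) hS hfin hv hT n
    exact ⟨t, hC.2.1⟩

/-- The composition has on `w` the accepting paths of the choice machine on the query. -/
theorem acceptingPaths_eq (hS : ∀ t j, ((OracleMachine.run R w t).core.tapes j).pos < S)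
    (hfin : R.final (OracleMachine.run R w TR).core.state = true)
    (hv : (OracleMachine.run R w TR).oracleTape = v)
    (hT : ∀ y t j, ((N.run v y t).core.tapes j).pos < S)
    (hTN : ∀ y, ∃ t, N.final (N.run v y t).core.state = true) :
    (compose R N).toChoiceMachine.acceptingPaths w = N.acceptingPaths v := by
  ext u
  simp only [ChoiceMachine.acceptingPaths, Set.mem_ofPred_eq, toChoice_run]
  generalize (fun i => u.getD i false) = y
  obtain ⟨TN, hTN⟩ := hTN y
  obtain ⟨t₀, -, h1, -, h2⟩ := run_spec hS hfin hv (hT y) hTN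
  have hrange : (Set.range fun t => ((compose R N).run w y t).toChoice.choicePos) =
    Set.range fun t => (N.run v y t).choicePos := h2
  rw [hrange]
  have hfin₀ : (compose R N).final ((compose R N).run w y t₀).state = true := by rw [h1]; exact hTN
  have hacc : (compose R N).accepting ((compose R N).run w y t₀).state =
    N.accepting (N.run v y TN).core.state := by rw [h1]
  refine and_congr_left fun _ => ⟨fun ⟨t, ht, ht'⟩ => ⟨TN, hTN, ?_⟩,
    fun ⟨t, ht, ht'⟩ => ⟨t₀, hfin₀, ?_⟩⟩
  · have : (compose R N).run w y t = (compose R N).run w y t₀ := iterate_eq_of_halted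
      (H := fun C : (compose R N).Config => (compose R N).final C.state = true)
      step_of_final ht hfin₀
    rw [← hacc, ← this]
    exact ht'
  · have : N.run v y t = N.run v y TN := iterate_eq_of_halted
      (H := fun C : N.Config => N.final C.core.state = true) (fun C hC => if_pos hC) ht hTN
    exact hacc.trans (this ▸ ht')

theorem readOnce (hN : N.ReadOnce) : (compose R N).toChoiceMachine.ReadOnce := by
  have hsweep : ∀ (q q' : CompState (Machine.State R) N.State) (op : _ → HeadOp)
      (s : Machine.Tape R ⊕ N.Tape → Cell) a m, m ≠ Move.left →
      (sweep q op s (q', a, m)).2.2 ≠ Move.left := by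
    intro q q' op s a m hm
    unfold sweep
    split_ifs
    · exact hm
    · exact Move.noConfusion
  intro q s b i
  change (composeδ R N q _ b i).2.2 ≠ Move.left
  cases q with
  | init | top => exact Move.noConfusion
  | sim =>
    simp only [composeδ]
    split_ifs <;> exact Move.noConfusion
  | ret => exact hsweep _ _ _ _ _ _ (hN _ _ _ _)
  | _ => exact hsweep _ _ _ _ _ _ Move.noConfusion

end compose

/-! ### Resource bounds -/

theorem computable_sum_range {f : ℕ → ℕ} (hf : Computable f) :
    Computable fun n => ∑ i ∈ Finset.range n, f i := by
  have h : Computable₂ fun (_ : ℕ) (p : ℕ × ℕ) => p.2 + f p.1 :=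
    (Primrec.nat_add.to_comp.comp (Computable.snd.comp Computable.snd)
      (hf.comp (Computable.fst.comp Computable.snd))).to₂
  refine (Computable.nat_rec Computable.id (Computable.const 0) h).of_eq fun n => ?_
  induction n with
  | zero => rfl
  | succ n ih => rw [Finset.sum_range_succ, ← ih]; rfl

/-- Upper bounds for `f` on `{0, …, g k}` that are computable from `k`. -/
theorem exists_computable_bound {f g : ℕ → ℕ} (hf : Computable f) (hg : Computable g) :
    ∃ h : ℕ → ℕ, Computable h ∧ ∀ k, ∀ k' ≤ g k, f k' ≤ h k :=
  ⟨fun k => ∑ i ∈ Finset.range (g k + 1), f i,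
    (computable_sum_range hf).comp (Computable.succ.comp hg), fun _ _ hk =>
      Finset.single_le_sum (f := f) (fun _ _ => Nat.zero_le _)
        (Finset.mem_range.2 (Nat.lt_succ_of_le hk))⟩

theorem log_pow_le {m : ℕ} (hm : 2 ≤ m) (a : ℕ) : Nat.log 2 (m ^ a) ≤ 2 * a * Nat.log 2 m := by
  have h1 : 1 ≤ Nat.log 2 m := Nat.log_pos one_lt_two hm
  calc Nat.log 2 (m ^ a) ≤ Nat.log 2 ((2 ^ (Nat.log 2 m + 1)) ^ a) :=
        Nat.log_mono_right (Nat.pow_le_pow_left (Nat.lt_pow_succ_log_self one_lt_two m).le a)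
    _ = (Nat.log 2 m + 1) * a := by rw [← pow_mul, Nat.log_pow one_lt_two]
    _ ≤ (2 * Nat.log 2 m) * a := by gcongr; omega
    _ = 2 * a * Nat.log 2 m := by ring

/-- In a space bound, an additive function of the parameter can be traded for a factor. -/
theorem log_add_le (n f : ℕ) : Nat.log 2 (n + f) ≤ Nat.log 2 (n + 2) * (f + 1) := by
  have h1 : 1 ≤ Nat.log 2 (n + 2) := Nat.log_pos one_lt_two (by omega)
  have h2 : n + f < 2 ^ (Nat.log 2 (n + 2) + 1 + f) := by
    have h3 : n + 2 < 2 ^ (Nat.log 2 (n + 2) + 1) := Nat.lt_pow_succ_log_self one_lt_two _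
    have h4 : f + 1 ≤ 2 ^ f := Nat.lt_two_pow_self
    calc n + f < (n + 2) * (f + 1) := by nlinarith [Nat.zero_le (n * f)]
      _ ≤ 2 ^ (Nat.log 2 (n + 2) + 1) * 2 ^ f := Nat.mul_le_mul h3.le h4
      _ = _ := (pow_add _ _ _).symm
  have h5 : Nat.log 2 (n + f) < Nat.log 2 (n + 2) + 1 + f :=
    Nat.log_lt_of_lt_pow' (by omega) h2
  nlinarith [Nat.zero_le f]

/-- The running time of the composition is polynomial in `m` if all its ingredients are. -/
theorem total_time_le {m b TN TR S : ℕ} (hm : 2 ≤ m) (hN : TN ≤ m ^ b) (hR : TR ≤ m ^ b)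
    (hS : S ≤ m ^ b) : TN * (TR * (2 * S + 3) + 4 * S + 6) + 1 ≤ m ^ (3 * b + 4) := by
  have hu : 1 ≤ m ^ b := Nat.one_le_pow _ _ (by omega)
  generalize hU : m ^ b = u at *
  have h16 : 2 ^ 4 ≤ m ^ 4 := Nat.pow_le_pow_left hm 4
  calc TN * (TR * (2 * S + 3) + 4 * S + 6) + 1
      ≤ u * (u * (2 * u + 3 * u) + 4 * (u * u) + 6 * (u * u)) + u * u * u := by
        gcongr <;> nlinarith
    _ = u ^ 3 * 2 ^ 4 := by ring
    _ ≤ u ^ 3 * m ^ 4 := by gcongr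
    _ = m ^ (3 * b + 4) := by rw [← hU, pow_add, pow_mul']

/-- The simulation of a counting machine for `F'` on the queries of a parsimonious reduction
from `F` to `F'` is a counting machine for `F`. -/
theorem compose_spec {F F' : ParamFun} {R : OracleMachine} {N : ChoiceMachine} {g : ℕ → ℕ}
    (hR : R.IsParaL) (hg : Computable g)
    (hred : ∀ (x : List Bool) (k : ℕ), ∃ (x' : List Bool) (k' : ℕ),
      R.Queries (encodeInput x k) (encodeInput x' k') ∧ k' ≤ g k ∧ F x k = F' x' k')
    (hN : N.IsParaL) (hb : N.IsKBounded) (hF : N.Counts F') :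
    (compose R N).toChoiceMachine.IsParaL ∧ (compose R N).toChoiceMachine.IsKBounded ∧
      (compose R N).toChoiceMachine.Counts F := by
  obtain ⟨fR, cR, hfR, hR⟩ := hR
  obtain ⟨fN, cN, hfN, hN⟩ := hN
  obtain ⟨fB, hfB, hb⟩ := hb
  obtain ⟨G, hG, hGle⟩ := exists_computable_bound hfN hg
  obtain ⟨H, hH, hHle⟩ := exists_computable_bound hfB hg
  -- The summand `2` makes the logarithm of `|x| + f k` positive.
  set f : ℕ → ℕ := fun k => fR k + G k + 2 with hf
  have hfc : Computable f := Primrec.nat_add.to_comp.comp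
    (Primrec.nat_add.to_comp.comp hfR hG) (Computable.const 2)
  -- `(|x| + f k) ^ a` bounds the size of the query, `K` is the constant in the space bound, and
  -- `(|x| + f k) ^ b` bounds both running times and the space.
  set a := cR + 2 with ha
  set K := cR + cN * (2 * a) with hK
  set b := a * cN + cR + K + 1 with hbdef
  have key : ∀ x k, ∃ x' k' TR, k' ≤ g k ∧ F x k = F' x' k' ∧
      TR ≤ (x.length + f k) ^ cR ∧
      R.final (OracleMachine.run R (encodeInput x k) TR).core.state = true ∧
      (OracleMachine.run R (encodeInput x k) TR).oracleTape = encodeInput x' k' ∧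
      x'.length + fN k' ≤ (x.length + f k) ^ a ∧ x'.length + 2 ≤ (x.length + f k) ^ a ∧
      (∀ t j, ((OracleMachine.run R (encodeInput x k) t).core.tapes j).pos <
        K * Nat.log 2 (x.length + f k)) ∧
      ∀ y t j, ((N.run (encodeInput x' k') y t).core.tapes j).pos <
        K * Nat.log 2 (x.length + f k) := by
    intro x k
    obtain ⟨x', k', ⟨t, ht, hv⟩, hk', hFF⟩ := hred x k
    obtain ⟨hS, TR, hTR, hfin⟩ := hR x k
    have hrun : OracleMachine.run R (encodeInput x k) TR = OracleMachine.run R (encodeInput x k) t :=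
      iterate_eq_of_halted (H := fun c : OracleMachine.Config R => R.final c.core.state = true)
        OracleMachine.step_of_final hfin ht
    have hm : 2 ≤ x.length + f k := by simp only [hf]; omega
    have hGm : G k ≤ x.length + f k := by simp only [hf]; omega
    have hRm : x.length + fR k ≤ x.length + f k := by simp only [hf]; omega
    generalize x.length + f k = m at *
    have hTRm : TR ≤ m ^ cR := hTR.trans (Nat.pow_le_pow_left hRm _)
    have hx' : x'.length ≤ m ^ cR := by
      have h1 := OracleMachine.length_oracleTape_le (R := R) (w := encodeInput x k) TR
      rw [hrun, hv] at h1
      simp only [encodeInput, List.length_append, List.length_replicate, List.length_cons] at h1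
      omega
    have hpow : ∀ z ≤ m, m ^ cR + z ≤ m ^ a := fun z hz => by
      have h1 : m ^ cR ≤ m ^ (cR + 1) := Nat.pow_le_pow_right (by omega) (by omega)
      have h2 : m ≤ m ^ (cR + 1) := Nat.le_self_pow (by omega) m
      have h3 : m ^ a = m ^ (cR + 1) * m := pow_succ _ _
      nlinarith
    have hxN : x'.length + fN k' ≤ m ^ a :=
      (Nat.add_le_add hx' (hGle k k' hk')).trans (hpow _ hGm)
    refine ⟨x', k', TR, hk', hFF, hTRm, hfin, by rw [hrun, hv], hxN,
      (Nat.add_le_add_right hx' 2).trans (hpow _ hm), fun t j => (hS t j).trans_le ?_,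
      fun y t j => ((hN x' k' y).1 t j).trans_le ?_⟩
    · exact Nat.mul_le_mul (by omega) (Nat.log_mono_right hRm)
    · calc cN * Nat.log 2 (x'.length + fN k')
          ≤ cN * (2 * a * Nat.log 2 m) :=
            Nat.mul_le_mul_left _ ((Nat.log_mono_right hxN).trans (log_pow_le hm a))
        _ = cN * (2 * a) * Nat.log 2 m := by ring
        _ ≤ K * Nat.log 2 m := Nat.mul_le_mul_right _ (by omega)
  refine ⟨⟨f, 3 * b + 4, hfc, fun x k y => ?_⟩,
    ⟨fun k => H k * (2 * a) * (f k + 1), ?_, fun x k y t => ?_⟩, fun x k => ?_⟩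
  · obtain ⟨x', k', TR, hk', -, hTR, hfin, hv, hx', -, hS, hT⟩ := key x k
    obtain ⟨TN, hTN, hNfin⟩ := (hN x' k' y).2
    obtain ⟨t₀, ht₀, hst, hpos, -⟩ := compose.run_spec hS hfin hv (hT y) hNfin
    have hm : 2 ≤ x.length + f k := by simp only [hf]; omega
    generalize x.length + f k = m at *
    have hlog : 1 ≤ Nat.log 2 m := Nat.log_pos one_lt_two hm
    have hmono : ∀ {i}, i ≤ b → m ^ i ≤ m ^ b := fun h => Nat.pow_le_pow_right (by omega) h
    refine ⟨fun t j => ?_, t₀, ht₀.trans (total_time_le (b := b) hm ?_ (hTR.trans (hmono ?_)) ?_), ?_⟩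
    · rw [CellMachine.toChoice_run]
      refine (hpos t j.1).trans_lt ?_
      exact Nat.mul_lt_mul_of_pos_right (by omega) hlog
    · calc TN ≤ (m ^ a) ^ cN := hTN.trans (Nat.pow_le_pow_left hx' _)
        _ = m ^ (a * cN) := (pow_mul _ _ _).symm
        _ ≤ m ^ b := hmono (by omega)
    · omega
    · calc K * Nat.log 2 m ≤ m ^ K * m :=
            Nat.mul_le_mul (Nat.lt_pow_self (by omega)).le (Nat.log_le_self 2 m)
        _ = m ^ (K + 1) := (pow_succ _ _).symm
        _ ≤ m ^ b := hmono (by omega)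
    · rw [CellMachine.toChoice_run]
      change (compose R N).final ((compose R N).run (encodeInput x k) y t₀).state = true
      rw [hst]
      exact hNfin
  · exact Primrec.nat_mul.to_comp.comp (Primrec.nat_mul.to_comp.comp hH (Computable.const _))
      (Computable.succ.comp hfc)
  · obtain ⟨x', k', TR, hk', -, hTR, hfin, hv, -, hx', hS, hT⟩ := key x k
    obtain ⟨TN, -, hNfin⟩ := (hN x' k' y).2
    obtain ⟨-, -, -, -, hrange⟩ := compose.run_spec hS hfin hv (hT y) hNfin
    obtain ⟨s, hs⟩ : ((compose R N).run (encodeInput x k) y t).choicePos ∈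
      Set.range fun t => (N.run (encodeInput x' k') y t).choicePos := hrange ▸ ⟨t, rfl⟩
    rw [CellMachine.toChoice_run]
    have hm : 2 ≤ x.length + f k := by simp only [hf]; omega
    calc ((compose R N).run (encodeInput x k) y t).choicePos
        = (N.run (encodeInput x' k') y s).choicePos := hs.symm
      _ ≤ fB k' * Nat.log 2 (x'.length + 2) := hb x' k' y s
      _ ≤ H k * (2 * a * (Nat.log 2 (x.length + 2) * (f k + 1))) :=
          Nat.mul_le_mul (hHle k k' hk') (((Nat.log_mono_right hx').trans (log_pow_le hm a)).trans
            (Nat.mul_le_mul_left _ (log_add_le _ _)))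
      _ = H k * (2 * a) * (f k + 1) * Nat.log 2 (x.length + 2) := by ring
  · obtain ⟨x', k', TR, -, hFF, -, hfin, hv, -, -, hS, hT⟩ := key x k
    rw [compose.acceptingPaths_eq hS hfin hv hT fun y => ?_, hF, hFF]
    obtain ⟨TN, -, hNfin⟩ := (hN x' k' y).2
    exact ⟨TN, hNfin⟩

end ParaLog

theorem mainTheorem11 :
    (∀ F F' : ParaLog.ParamFun, ParaLog.ParsReducible F F' →
      F' ∈ ParaLog.SharpParaWL → F ∈ ParaLog.SharpParaWL) ∧
    (∀ F F' : ParaLog.ParamFun, ParaLog.ParsReducible F F' →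
      F' ∈ ParaLog.SharpParaBetaL → F ∈ ParaLog.SharpParaBetaL) := by
  constructor
  · rintro F F' ⟨R, hR, g, hg, hred⟩ ⟨N, hN, hb, hF⟩
    exact ⟨_, ParaLog.compose_spec hR hg hred hN hb hF⟩
  · rintro F F' ⟨R, hR, g, hg, hred⟩ ⟨N, hN, hb, hro, hF⟩
    obtain ⟨h1, h2, h3⟩ := ParaLog.compose_spec hR hg hred hN hb hF
    exact ⟨_, h1, h2, ParaLog.compose.readOnce hro, h3⟩
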